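/- Let $Q\subset\mathbb{C}$ be the open domain bounded by a simple (convex or concave) quadrilateral with consecutive vertices $b_1,b_2,b_3,b_4$ in counterclockwise order, and suppose $Q$ is a Pitot quadrilateral, i.e. $|b_1-b_2|+|b_3-b_4|=|b_2-b_3|+|b_4-b_1|$. Then $b_2$ and $b_4$ lie on the same branch of a hyperbola with foci $b_1,b_3$ (a line if $m=0$ below): there are $m\in(-\pi/2,\pi/2)$ and $t<s$ in $\mathbb{R}$ such that $$|b_2-b_1|-|b_2-b_3|=|b_4-b_1|-|b_4-b_3|=|b_3-b_1|\sin m,$$ $$b_2=\tfrac{b_1+b_3}{2}+\tfrac{b_3-b_1}{2}\left(\sin m\cosh t+i\cos m\sinh t\right),\qquad b_4=\tfrac{b_1+b_3}{2}+\tfrac{b_3-b_1}{2}\left(\sin m\cosh s+i\cos m\sinh s\right).$$ Put $$p=\arccos\left(1-\frac{4}{1+\cosh(s-t)}\right),\qquad X=\frac{\overline{b_3-b_1}}{|b_3-b_1|}\cdot\frac{\left(ie^{s/2}+e^{t/2}\right)\left(1+e^{im+(s+t)/2}\right)}{\left(e^{s/2}+ie^{t/2}\right)\left(e^{im}+e^{(s+t)/2}\right)},$$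 $$z_\circ=\frac{\left(e^{s/2}+ie^{t/2}\right)\left(1-e^{im+(s+t)/2}\right)}{\left(e^{s/2}-ie^{t/2}\right)\left(1+e^{im+(s+t)/2}\right)}.$$ Then $p\in(0,\pi)$, $|X|=1$, $|z_\circ|<1$, so that $\phi(z)=X\dfrac{z-z_\circ}{1-z\overline{z_\circ}}$ is a Möbius automorphism of the unit disk $\mathbb{D}$. Let $F:[0,2\pi)\to\mathbb{C}$ be the step function with values $b_4,b_1,b_2,b_3$ on $[0,p),[p,\pi),[\pi,\pi+p),[\pi+p,2\pi)$ respectively, and let $$f(z)=\frac1{2\pi}\int_0^{2\pi}\frac{1-|z|^2}{|e^{i\theta}-z|^2}F(\theta)\,d\theta,\qquad z\in\mathbb{D},$$ be its Poisson extension. Then $f$ is harmonic and sense-preserving (its Jacobian is positive) on $\mathbb{D}$; it can be written as $f=h+\overline{g}$ with $h,g$ analytic in $\mathbb{D}$, $g(0)=0$, $h'\neq0$ on $\mathbb{D}$, and $g'/h'=\phi^2$ on $\mathbb{D}$; and $f$ is a $C^\infty$ diffeomorphism of $\mathbb{D}$ onto $Q$. -/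

import Mathlib

open scoped ComplexConjugate ContDiff

/-- The closed polygonal line with successive vertices `b₁, b₂, b₃, b₄`. -/
def quadBoundary (b₁ b₂ b₃ b₄ : ℂ) : Set ℂ :=
  segment ℝ b₁ b₂ ∪ segment ℝ b₂ b₃ ∪ segment ℝ b₃ b₄ ∪ segment ℝ b₄ b₁

/-- The open quadrilateral: the points off the boundary line that lie in a bounded connected
component of its complement. -/
def quadInterior (b₁ b₂ b₃ b₄ : ℂ) : Set ℂ :=
  {c | c ∉ quadBoundary b₁ b₂ b₃ b₄ ∧
    Bornology.IsBounded (connectedComponentIn (quadBoundary b₁ b₂ b₃ b₄)ᶜ c)}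

/-- Signed area (shoelace formula). -/
noncomputable def quadSignedArea (b₁ b₂ b₃ b₄ : ℂ) : ℝ :=
  ((conj b₁ * b₂).im + (conj b₂ * b₃).im + (conj b₃ * b₄).im + (conj b₄ * b₁).im) / 2

/-- `b₁, b₂, b₃, b₄` are the consecutive vertices, in counterclockwise order, of a simple
quadrilateral, convex or not: consecutive sides meet only in their common vertex and opposite sides
are disjoint (in particular the four vertices are distinct). -/
structure IsQuadrilateral (b₁ b₂ b₃ b₄ : ℂ) : Prop where
  inter₁ : segment ℝ b₄ b₁ ∩ segment ℝ b₁ b₂ = {b₁}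
  inter₂ : segment ℝ b₁ b₂ ∩ segment ℝ b₂ b₃ = {b₂}
  inter₃ : segment ℝ b₂ b₃ ∩ segment ℝ b₃ b₄ = {b₃}
  inter₄ : segment ℝ b₃ b₄ ∩ segment ℝ b₄ b₁ = {b₄}
  disj₁₃ : Disjoint (segment ℝ b₁ b₂) (segment ℝ b₃ b₄)
  disj₂₄ : Disjoint (segment ℝ b₂ b₃) (segment ℝ b₄ b₁)
  counterclockwise : 0 < quadSignedArea b₁ b₂ b₃ b₄

/-- A Pitot quadrilateral: the two pairs of opposite sides have the same total length. -/
structure IsPitotQuadrilateral (b₁ b₂ b₃ b₄ : ℂ) : Prop extends IsQuadrilateral b₁ b₂ b₃ b₄ where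
  pitot : dist b₁ b₂ + dist b₃ b₄ = dist b₂ b₃ + dist b₄ b₁

/-- The step function with values `b₄, b₁, b₂, b₃` on the arcs `[0, p)`, `[p, π)`, `[π, π + p)`,
`[π + p, 2π)`; only its values on `[0, 2π)` are used. -/
noncomputable def stepFunction (b₁ b₂ b₃ b₄ : ℂ) (p θ : ℝ) : ℂ :=
  if θ < p then b₄ else if θ < Real.pi then b₁ else if θ < Real.pi + p then b₂ else b₃

/-- The Poisson integral of a boundary function `F` on `[0, 2π)`, for `z` in the unit disk. -/
noncomputable def poissonExtension (F : ℝ → ℂ) (z : ℂ) : ℂ :=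
  (1 / (2 * Real.pi) : ℝ) *
    ∫ θ in (0 : ℝ)..(2 * Real.pi),
      (((1 - ‖z‖ ^ 2) / ‖Complex.exp (θ * Complex.I) - z‖ ^ 2 : ℝ) : ℂ) * F θ

/-- `f` restricts to a (smooth) diffeomorphism of `U` onto `V`. -/
def IsDiffeoOnto (f : ℂ → ℂ) (U V : Set ℂ) : Prop :=
  IsOpen U ∧ IsOpen V ∧ Set.BijOn f U V ∧ ContDiffOn ℝ ∞ f U ∧
    ∃ k : ℂ → ℂ, ContDiffOn ℝ ∞ k V ∧ ∀ z ∈ U, k (f z) = z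

/-- `f` preserves orientation on `U`: its Jacobian determinant is positive there. -/
def IsSensePreservingOn (f : ℂ → ℂ) (U : Set ℂ) : Prop :=
  ∀ z ∈ U, DifferentiableAt ℝ f z ∧ 0 < (fderiv ℝ f z).det

/-- The point with hyperbolic coordinate `τ` on the branch
`‖ζ - b₁‖ - ‖ζ - b₃‖ = ‖b₃ - b₁‖ * sin m` of the hyperbola with foci `b₁` and `b₃`
(for `b₁ = -1`, `b₃ = 1` it is `sin m * cosh τ + i * cos m * sinh τ`). -/
noncomputable def hyperbolaPoint (b₁ b₃ : ℂ) (m τ : ℝ) : ℂ :=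
  (b₁ + b₃) / 2 +
    (b₃ - b₁) / 2 *
      ((Real.sin m * Real.cosh τ : ℝ) + (Real.cos m * Real.sinh τ : ℝ) * Complex.I)

/-- The Möbius map `z ↦ X (z - a) / (1 - z * conj a)`. -/
noncomputable def diskMobius (X a z : ℂ) : ℂ := X * ((z - a) / (1 - z * conj a))

/-! The value f(z) is the convex combination of the four vertices whose weights are the harmonic
measures of four arcs, and these are, up to constants, imaginary parts of logarithms. Hence f = h +
conj g, where h' and g' are constant multiples of quadratic polynomials divided by (1 - z²)(w² -
z²), with w = exp(ip).

The Pitot condition puts b₂ and b₄ on one branch of a hyperbola with foci b₁, b₃. In the normalised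
parametrisation sin(m + iτ), the chosen p makes both quadratics perfect squares: this is
`jumpNumerator_hyperbola`, used with μ = exp(im) for h' and with -1/μ for g'. The linear factor of
g' vanishes at z₀, that of h' at the reflection of z₀ in the unit circle. So h' has no zero in the
disk, g'/h' is the square of a disk automorphism (`jumpNumerator_dilatation`), and the Jacobian
|h'|² - |g'|² is positive.

Bijectivity is topological, since Q need not be convex. At each point of the circle two of the
weights tend to 0, so every cluster value of f lies on a side (`mem_quadBoundary_of_tendsto`). A
simple quadrilateral is star-shaped about the midpoint of a suitable diagonal, and its boundary is a
level set {G = 1} of a gauge. As f is open, G ∘ f has no positive local maximum; together with the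
cluster values this forces G ∘ f < 1. Thus f is a proper local homeomorphism into a contractible
domain, hence a covering, hence bijective (`IsCenteredGauge.bijOn_ball`). -/

/-! ### Bounded star-shaped domains and their gauges -/

/-- `G` is the gauge, centred at `c`, of a bounded star-shaped domain with boundary `B`. -/
structure IsCenteredGauge (B : Set ℂ) (c : ℂ) (G : ℂ → ℝ) : Prop where
  continuous : Continuous G
  nonneg : ∀ z, 0 ≤ G z
  homogeneous : ∀ (l : ℝ) (z : ℂ), 0 ≤ l → G (c + l * (z - c)) = l * G z
  boundary_eq : B = {z | G z = 1}
  exists_bound : ∃ M : ℝ, ∀ z, ‖z - c‖ ≤ M * G z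

namespace IsCenteredGauge

variable {B : Set ℂ} {c : ℂ} {G : ℂ → ℝ}

theorem apply_center (hG : IsCenteredGauge B c G) : G c = 0 := by
  simpa using hG.homogeneous 0 c le_rfl

theorem starConvex (hG : IsCenteredGauge B c G) : StarConvex ℝ c {z | G z < 1} := by
  rw [starConvex_iff_forall_pos (by simp [hG.apply_center])]
  intro z hz a b ha hb hab
  have : a • c + b • z = c + (b : ℂ) * (z - c) := by
    have : (a : ℂ) = 1 - b := by rw [eq_sub_iff_add_eq]; exact_mod_cast hab
    simp only [Complex.real_smul, this]; ring
  simp only [Set.mem_ofPred_eq, this, hG.homogeneous b z hb.le] at hz ⊢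
  nlinarith

/-- If G z > 1, the outward ray from z never meets B, so its component is unbounded. If G z < 1,
then G, which omits the value 1 on the component, stays below 1 there, and this region is bounded.
-/
theorem component_eq (hG : IsCenteredGauge B c G) :
    {z | z ∉ B ∧ Bornology.IsBounded (connectedComponentIn Bᶜ z)} = {z | G z < 1} := by
  obtain ⟨M, hM⟩ := hG.exists_bound
  have hB := hG.boundary_eq
  ext z
  simp only [Set.mem_ofPred_eq]
  constructor
  · rintro ⟨hz, hb⟩
    by_contra! hlt
    have hne : G z ≠ 1 := by simpa [hB] using hz
    have hgt : 1 < G z := lt_of_le_of_ne hlt hne.symm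
    have hzc : z - c ≠ 0 := by
      intro h
      rw [sub_eq_zero.1 h, hG.apply_center] at hlt
      linarith
    have hsub : (fun l : ℝ => c + l * (z - c)) '' Set.Ici 1 ⊆ connectedComponentIn Bᶜ z := by
      apply IsPreconnected.subset_connectedComponentIn
      · exact isPreconnected_Ici.image _ (by fun_prop)
      · exact ⟨1, by simp, by simp⟩
      · rintro _ ⟨l, hl, rfl⟩
        have hl : (1 : ℝ) ≤ l := hl
        have h1 := hG.homogeneous l z (by linarith)
        simp only [hB, Set.mem_compl_iff, Set.mem_ofPred_eq, h1]
        nlinarith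
    obtain ⟨R, hR⟩ := (hb.subset hsub).exists_norm_le
    have hpos : 0 < ‖z - c‖ := norm_pos_iff.2 hzc
    set l : ℝ := 1 + (|R| + ‖c‖) / ‖z - c‖ with hl
    have hl1 : 1 ≤ l := by rw [hl]; have : 0 ≤ (|R| + ‖c‖) / ‖z - c‖ := by positivity
                           linarith
    have h2 := hR _ ⟨l, hl1, rfl⟩
    have h3 : ‖(l : ℂ) * (z - c)‖ ≤ R + ‖c‖ := by
      calc ‖(l : ℂ) * (z - c)‖ = ‖(c + l * (z - c)) - c‖ := by ring_nf
        _ ≤ _ := (norm_sub_le _ _).trans (by simpa using h2)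
    rw [norm_mul, Complex.norm_real, Real.norm_of_nonneg (by linarith)] at h3
    have h4 : l * ‖z - c‖ = ‖z - c‖ + (|R| + ‖c‖) := by rw [hl]; field_simp
    have := le_abs_self R
    linarith
  · intro hz
    have hzB : z ∉ B := by simp [hB]; exact hz.ne
    refine ⟨hzB, ?_⟩
    have hsub : connectedComponentIn Bᶜ z ⊆ {z | G z < 1} := by
      intro y hy
      by_contra! hy1
      have hy1 : 1 ≤ G y := by simpa using hy1
      have hpre : IsPreconnected (G '' connectedComponentIn Bᶜ z) :=
        isPreconnected_connectedComponentIn.image _ hG.continuous.continuousOn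
      have := hpre.ordConnected.out ⟨z, mem_connectedComponentIn hzB, rfl⟩ ⟨y, hy, rfl⟩
        (⟨le_of_lt hz, hy1⟩ : (1 : ℝ) ∈ Set.Icc (G z) (G y))
      obtain ⟨x, hx, hx1⟩ := this
      have := connectedComponentIn_subset _ _ hx
      simp [hB, hx1] at this
    refine Bornology.IsBounded.subset ?_ hsub
    refine (Metric.isBounded_closedBall (x := c) (r := |M|)).subset fun y hy => ?_
    have hy : G y < 1 := hy
    rw [mem_closedBall_iff_norm]
    have h0 := hM y
    have h1 := hG.nonneg y
    have h2 := le_abs_self M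
    nlinarith [abs_nonneg M]

end IsCenteredGauge

/-! ### Every simple quadrilateral is star-shaped -/

/-- The gauge centred at `0` of the quadrilateral with vertices `1, a, -1, b`, where `a` lies in the
upper and `b` in the lower half-plane. -/
noncomputable def kiteGauge (a b z : ℂ) : ℝ :=
  |z.re - max z.im 0 / a.im * a.re - max (-z.im) 0 / (-b.im) * b.re| +
    max z.im 0 / a.im + max (-z.im) 0 / (-b.im)

/-- With z = x + y a, x and y real, this is |x| + y: the ℓ¹ norm in the skew coordinates of the
half-plane, whose unit level set consists of the two sides through a. -/
theorem kiteGauge_of_im_nonneg {a b z : ℂ} (hz : 0 ≤ z.im) :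
    kiteGauge a b z = |z.re - z.im / a.im * a.re| + z.im / a.im := by
  simp [kiteGauge, hz]

theorem kiteGauge_of_im_nonpos {a b z : ℂ} (hz : z.im ≤ 0) :
    kiteGauge a b z = |z.re - z.im / b.im * b.re| + z.im / b.im := by
  simp [kiteGauge, hz, neg_div_neg_eq]

theorem continuous_kiteGauge (a b : ℂ) : Continuous (kiteGauge a b) := by
  have h1 := Complex.continuous_re
  have h2 := Complex.continuous_im
  unfold kiteGauge
  fun_prop

theorem kiteGauge_nonneg {a b : ℂ} (ha : 0 < a.im) (hb : b.im < 0) (z : ℂ) :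
    0 ≤ kiteGauge a b z := by
  have : 0 < -b.im := by linarith
  unfold kiteGauge
  positivity

theorem kiteGauge_mul {a b : ℂ} (l : ℝ) (hl : 0 ≤ l) (z : ℂ) :
    kiteGauge a b (l * z) = l * kiteGauge a b z := by
  rcases le_total 0 z.im with h | h
  · rw [kiteGauge_of_im_nonneg h, kiteGauge_of_im_nonneg (by simp; positivity)]
    simp only [Complex.re_ofReal_mul, Complex.im_ofReal_mul, mul_add]
    rw [← abs_of_nonneg hl, ← abs_mul, abs_of_nonneg hl]
    ring_nf
  · rw [kiteGauge_of_im_nonpos h, kiteGauge_of_im_nonpos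
      (by simp; exact mul_nonpos_of_nonneg_of_nonpos hl h)]
    simp only [Complex.re_ofReal_mul, Complex.im_ofReal_mul, mul_add]
    rw [← abs_of_nonneg hl, ← abs_mul, abs_of_nonneg hl]
    ring_nf

theorem norm_le_kiteGauge {a b : ℂ} (ha : 0 < a.im) (hb : b.im < 0) (z : ℂ) :
    ‖z‖ ≤ (1 + ‖a‖ + ‖b‖) * kiteGauge a b z := by
  have key : ∀ w : ℂ, w.im ≠ 0 → 0 ≤ z.im / w.im →
      ‖z‖ ≤ |z.re - z.im / w.im * w.re| + z.im / w.im * ‖w‖ := by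
    intro w hw h
    have : z = ((z.re - z.im / w.im * w.re : ℝ) : ℂ) + (z.im / w.im : ℝ) * w := by
      apply Complex.ext
      · simp
      · rw [Complex.add_im, Complex.im_ofReal_mul, Complex.ofReal_im]; field_simp; simp
    calc ‖z‖ = _ := congrArg _ this
      _ ≤ _ := norm_add_le _ _
      _ = _ := by rw [norm_mul, Complex.norm_real, Complex.norm_real, Real.norm_eq_abs,
                    Real.norm_of_nonneg h]
  have na := norm_nonneg a
  have nb := norm_nonneg b
  rcases le_total 0 z.im with h | h
  · rw [kiteGauge_of_im_nonneg h]
    have h1 : 0 ≤ z.im / a.im := by positivity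
    have := key a ha.ne' h1
    nlinarith [abs_nonneg (z.re - z.im / a.im * a.re)]
  · rw [kiteGauge_of_im_nonpos h]
    have h1 : 0 ≤ z.im / b.im := div_nonneg_of_nonpos h hb.le
    have := key b hb.ne h1
    nlinarith [abs_nonneg (z.re - z.im / b.im * b.re)]

theorem quadBoundary_kite {a b : ℂ} (ha : 0 < a.im) (hb : b.im < 0) :
    quadBoundary 1 a (-1) b = {z | kiteGauge a b z = 1} := by
  have up : ∀ (σ l k : ℝ) (w z : ℂ), w.im ≠ 0 → (σ = 1 ∨ σ = -1) → 0 ≤ l → 0 ≤ k → l + k = 1 →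
      (l : ℂ) * σ + k * w = z →
      0 ≤ z.im / w.im ∧ |z.re - z.im / w.im * w.re| + z.im / w.im = 1 := by
    rintro σ l k w z hw hσ hl hk hlk rfl
    have e1 : ((l : ℂ) * σ + k * w).im = k * w.im := by simp
    have e2 : ((l : ℂ) * σ + k * w).re = l * σ + k * w.re := by simp
    rw [e1, e2, mul_div_assoc, div_self hw, mul_one]
    refine ⟨hk, ?_⟩
    rw [add_sub_cancel_right, abs_mul, abs_of_nonneg hl]
    rcases hσ with rfl | rfl <;> simpa using hlk
  have down : ∀ (w z : ℂ), w.im ≠ 0 → 0 ≤ z.im / w.im →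
      |z.re - z.im / w.im * w.re| + z.im / w.im = 1 → z ∈ segment ℝ 1 w ∨ z ∈ segment ℝ (-1) w := by
    intro w z hw h h1
    have hz : ∀ σ : ℝ, σ * |z.re - z.im / w.im * w.re| = z.re - z.im / w.im * w.re →
        (|z.re - z.im / w.im * w.re|) • (σ : ℂ) + (z.im / w.im) • w = z := by
      intro σ hσ
      apply Complex.ext
      · simp only [Complex.add_re, Complex.real_smul, Complex.re_ofReal_mul, Complex.ofReal_re]
        linarith
      · simp only [Complex.add_im, Complex.real_smul, Complex.im_ofReal_mul, Complex.ofReal_im]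
        field_simp; simp
    rcases le_total 0 (z.re - z.im / w.im * w.re) with h2 | h2
    · exact Or.inl ⟨_, _, abs_nonneg _, h, h1, by simpa using hz 1 (by rw [abs_of_nonneg h2]; ring)⟩
    · exact Or.inr ⟨_, _, abs_nonneg _, h, h1, by
        simpa using hz (-1) (by rw [abs_of_nonpos h2]; ring)⟩
  have mem : ∀ (σ : ℝ) (w z : ℂ), (σ = 1 ∨ σ = -1) → w.im ≠ 0 → z ∈ segment ℝ (σ : ℂ) w →
      0 ≤ z.im / w.im ∧ |z.re - z.im / w.im * w.re| + z.im / w.im = 1 := by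
    rintro σ w z hσ hw ⟨l, k, hl, hk, hlk, e⟩
    exact up σ l k w z hw hσ hl hk hlk (by simpa using e)
  have fa : ∀ z : ℂ, 0 ≤ z.im / a.im → 0 ≤ z.im := fun z hz => by
    rw [← div_mul_cancel₀ z.im ha.ne']; positivity
  have fb : ∀ z : ℂ, 0 ≤ z.im / b.im → z.im ≤ 0 := fun z hz => by
    rw [← div_mul_cancel₀ z.im hb.ne]; exact mul_nonpos_of_nonneg_of_nonpos hz hb.le
  ext z
  simp only [quadBoundary, Set.mem_union, Set.mem_ofPred_eq]
  rw [segment_symm ℝ a (-1), segment_symm ℝ b 1]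
  constructor
  · rintro (((h | h) | h) | h)
    · obtain ⟨h1, h2⟩ := mem 1 a z (.inl rfl) ha.ne' (by simpa using h)
      rwa [kiteGauge_of_im_nonneg (fa z h1)]
    · obtain ⟨h1, h2⟩ := mem (-1) a z (.inr rfl) ha.ne' (by simpa using h)
      rwa [kiteGauge_of_im_nonneg (fa z h1)]
    · obtain ⟨h1, h2⟩ := mem (-1) b z (.inr rfl) hb.ne (by simpa using h)
      rwa [kiteGauge_of_im_nonpos (fb z h1)]
    · obtain ⟨h1, h2⟩ := mem 1 b z (.inl rfl) hb.ne (by simpa using h)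
      rwa [kiteGauge_of_im_nonpos (fb z h1)]
  · intro h
    rcases le_total 0 z.im with h1 | h1
    · rw [kiteGauge_of_im_nonneg h1] at h
      rcases down a z ha.ne' (by positivity) h with h | h <;> simp [h]
    · rw [kiteGauge_of_im_nonpos h1] at h
      rcases down b z hb.ne (div_nonneg_of_nonpos h1 hb.le) h with h | h <;> simp [h]

theorem quadBoundary_rotate (b₁ b₂ b₃ b₄ : ℂ) :
    quadBoundary b₁ b₂ b₃ b₄ = quadBoundary b₂ b₃ b₄ b₁ := by
  simp only [quadBoundary]
  ext z; simp only [Set.mem_union]; tauto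

theorem mem_segment_affine {c e x y z : ℂ} (he : e ≠ 0) :
    z ∈ segment ℝ (c + e * x) (c + e * y) ↔ (z - c) / e ∈ segment ℝ x y := by
  constructor
  · rintro ⟨l, k, hl, hk, hlk, rfl⟩
    refine ⟨l, k, hl, hk, hlk, ?_⟩
    have : (l : ℂ) = 1 - k := by rw [eq_sub_iff_add_eq]; exact_mod_cast hlk
    simp only [Complex.real_smul, this]
    field_simp; ring
  · rintro ⟨l, k, hl, hk, hlk, h⟩
    refine ⟨l, k, hl, hk, hlk, ?_⟩
    have : (l : ℂ) = 1 - k := by rw [eq_sub_iff_add_eq]; exact_mod_cast hlk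
    simp only [Complex.real_smul, this] at h ⊢
    rw [eq_div_iff he] at h
    linear_combination h

/-- Twice the signed area of a triangle. -/
noncomputable def orientedArea (x y z : ℂ) : ℝ := (conj (y - x) * (z - x)).im

/-- The two positively oriented triangles lie on opposite sides of the diagonal b₁b₃. The affine map
sending its ends to 1 and -1 reduces to the kite. -/
theorem exists_centeredGauge_of_diagonal {b₁ b₂ b₃ b₄ : ℂ} (h2 : 0 < orientedArea b₁ b₂ b₃)
    (h4 : 0 < orientedArea b₁ b₃ b₄) :
    ∃ c G, IsCenteredGauge (quadBoundary b₁ b₂ b₃ b₄) c G := by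
  set c := (b₁ + b₃) / 2 with hc
  set e := (b₁ - b₃) / 2 with he'
  have he : e ≠ 0 := by
    intro h
    have : b₁ = b₃ := by rw [he'] at h; linear_combination 2 * h
    simp [orientedArea, this] at h4
  set a := (b₂ - c) / e with ha
  set b := (b₄ - c) / e with hb
  have im_div : ∀ w : ℂ, (w / e).im = (e.re * w.im - e.im * w.re) / Complex.normSq e := by
    intro w
    rw [Complex.div_im]
    ring
  have hn : 0 < Complex.normSq e := Complex.normSq_pos.2 he
  have ha0 : 0 < a.im := by
    rw [ha, im_div]
    refine div_pos ?_ hn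
    simp [orientedArea] at h2
    simp [he', hc]
    nlinarith
  have hb0 : b.im < 0 := by
    rw [hb, im_div]
    refine div_neg_of_neg_of_pos ?_ hn
    simp [orientedArea] at h4
    simp [he', hc]
    nlinarith
  refine ⟨c, fun z => kiteGauge a b ((z - c) / e), ?_, fun z => kiteGauge_nonneg ha0 hb0 _, ?_, ?_,
    ‖e‖ * (1 + ‖a‖ + ‖b‖), ?_⟩
  · exact (continuous_kiteGauge a b).comp (by fun_prop)
  · intro l z hl
    rw [← kiteGauge_mul l hl]
    ring_nf
  · have h := quadBoundary_kite ha0 hb0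
    ext z
    have hz := congrArg (fun s => (z - c) / e ∈ s) h
    simp only [quadBoundary, Set.mem_union, Set.mem_ofPred_eq, ← mem_segment_affine he,
      eq_iff_iff] at hz ⊢
    rw [← hz]
    have e1 : c + e * 1 = b₁ := by rw [hc, he']; ring
    have e2 : c + e * a = b₂ := by rw [ha]; field_simp; ring
    have e3 : c + e * (-1) = b₃ := by rw [hc, he']; ring
    have e4 : c + e * b = b₄ := by rw [hb]; field_simp; ring
    rw [e1, e2, e3, e4]
  · intro z
    have := norm_le_kiteGauge ha0 hb0 ((z - c) / e)
    have he0 := norm_pos_iff.2 he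
    rw [norm_div, div_le_iff₀ he0] at this
    linarith

/-- The doubled triangle areas Aᵢ (corner at bᵢ) satisfy A₁ + A₃ = A₂ + A₄ > 0 and A₃b₁ + A₁b₃ =
A₄b₂ + A₂b₄. If each pair contained a nonpositive area, moving those two terms across the relation
would exhibit a common point of two opposite sides. -/
theorem IsQuadrilateral.exists_diagonal {b₁ b₂ b₃ b₄ : ℂ} (h : IsQuadrilateral b₁ b₂ b₃ b₄) :
    (0 < orientedArea b₁ b₂ b₃ ∧ 0 < orientedArea b₁ b₃ b₄) ∨
      (0 < orientedArea b₂ b₃ b₄ ∧ 0 < orientedArea b₂ b₄ b₁) := by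
  have area := h.counterclockwise
  have d1 := Set.disjoint_left.1 h.disj₁₃
  have d2 := Set.disjoint_left.1 h.disj₂₄
  set A2 := orientedArea b₁ b₂ b₃ with hA2
  set A4 := orientedArea b₁ b₃ b₄ with hA4
  set A3 := orientedArea b₂ b₃ b₄ with hA3
  set A1 := orientedArea b₂ b₄ b₁ with hA1
  have s1 : A1 + A3 = A2 + A4 := by
    simp [hA1, hA2, hA3, hA4, orientedArea]; ring
  have s2 : 0 < A1 + A3 := by
    simp [quadSignedArea] at area
    simp [hA1, hA3, orientedArea]; nlinarith
  have rel : (A3 : ℂ) * b₁ + A1 * b₃ = A4 * b₂ + A2 * b₄ := by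
    apply Complex.ext
    · simp [hA1, hA2, hA3, hA4, orientedArea]; ring
    · simp [hA1, hA2, hA3, hA4, orientedArea]; ring
  have seg : ∀ (k l : ℝ) (x y z : ℂ), 0 ≤ k → 0 ≤ l → 0 < k + l →
      (k : ℂ) * x + l * y = (k + l) * z →
      z ∈ segment ℝ x y := by
    intro k l x y z hk hl hkl e
    have hkl' : (k : ℂ) + l ≠ 0 := by exact_mod_cast hkl.ne'
    refine ⟨k / (k + l), l / (k + l), by positivity, by positivity, by field_simp, ?_⟩
    simp only [Complex.real_smul]; push_cast; field_simp; exact e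
  have meet : ∀ (k l k' l' : ℝ) (x y x' y' : ℂ), 0 ≤ k → 0 ≤ l → 0 < k + l → 0 ≤ k' → 0 ≤ l' →
      k + l = k' + l' → (k : ℂ) * x + l * y = k' * x' + l' * y' →
      ∃ z, z ∈ segment ℝ x y ∧ z ∈ segment ℝ x' y' := by
    intro k l k' l' x y x' y' hk hl hkl hk' hl' hs e
    have hkl' : (k : ℂ) + l ≠ 0 := by exact_mod_cast hkl.ne'
    have hs' : (k : ℂ) + l = k' + l' := by exact_mod_cast hs
    refine ⟨(k * x + l * y) / (k + l), seg k l x y _ hk hl hkl (by field_simp),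
      seg k' l' x' y' _ hk' hl' (hs ▸ hkl) ?_⟩
    rw [← hs', ← e]; field_simp
  by_contra hcon
  rw [not_or, not_and_or, not_and_or, not_lt, not_lt, not_lt, not_lt] at hcon
  obtain ⟨h24 | h24, h13 | h13⟩ := hcon
  · obtain ⟨z, hz1, hz2⟩ := meet A1 (-A2) A4 (-A3) b₃ b₄ b₂ b₁ (by linarith) (by linarith)
      (by linarith) (by linarith) (by linarith) (by linarith) (by push_cast; linear_combination rel)
    exact d1 (segment_symm ℝ b₁ b₂ ▸ hz2) hz1
  · obtain ⟨z, hz1, hz2⟩ := meet A3 (-A2) A4 (-A1) b₁ b₄ b₂ b₃ (by linarith) (by linarith)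
      (by linarith) (by linarith) (by linarith) (by linarith) (by push_cast; linear_combination rel)
    exact d2 hz2 (segment_symm ℝ b₄ b₁ ▸ hz1)
  · obtain ⟨z, hz1, hz2⟩ := meet A1 (-A4) A2 (-A3) b₃ b₂ b₄ b₁ (by linarith) (by linarith)
      (by linarith) (by linarith) (by linarith) (by linarith) (by push_cast; linear_combination rel)
    exact d2 (segment_symm ℝ b₂ b₃ ▸ hz1) hz2
  · obtain ⟨z, hz1, hz2⟩ := meet A3 (-A4) A2 (-A1) b₁ b₂ b₄ b₃ (by linarith) (by linarith)
      (by linarith) (by linarith) (by linarith) (by linarith) (by push_cast; linear_combination rel)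
    exact d1 hz1 (segment_symm ℝ b₃ b₄ ▸ hz2)

theorem IsQuadrilateral.exists_centeredGauge {b₁ b₂ b₃ b₄ : ℂ} (h : IsQuadrilateral b₁ b₂ b₃ b₄) :
    ∃ c G, IsCenteredGauge (quadBoundary b₁ b₂ b₃ b₄) c G := by
  rcases h.exists_diagonal with ⟨h1, h2⟩ | ⟨h1, h2⟩
  · exact exists_centeredGauge_of_diagonal h1 h2
  · rw [quadBoundary_rotate]
    exact exists_centeredGauge_of_diagonal h1 h2

/-! ### Poisson kernel and harmonic measure of arcs -/

/-- The branch of `log (1 - z * exp (-iθ))` on the unit disk. -/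
noncomputable def circleLog (θ : ℝ) (z : ℂ) : ℂ :=
  Complex.log (1 - z * Complex.exp (-(θ * Complex.I)))

theorem norm_exp_neg_ofReal_mul_I (θ : ℝ) : ‖Complex.exp (-(θ * Complex.I))‖ = 1 := by
  rw [← neg_mul, ← Complex.ofReal_neg, Complex.norm_exp_ofReal_mul_I]

theorem one_sub_mul_exp_mem_slitPlane {z : ℂ} (hz : ‖z‖ < 1) (θ : ℝ) :
    1 - z * Complex.exp (-(θ * Complex.I)) ∈ Complex.slitPlane := by
  left
  have h := Complex.re_le_norm (z * Complex.exp (-(θ * Complex.I)))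
  rw [norm_mul, norm_exp_neg_ofReal_mul_I, mul_one] at h
  simp only [Complex.sub_re, Complex.one_re]
  linarith

theorem exp_sub_ne_zero {z : ℂ} (hz : ‖z‖ < 1) (θ : ℝ) : Complex.exp (θ * Complex.I) - z ≠ 0 := by
  intro h
  have := Complex.norm_exp_ofReal_mul_I θ
  rw [sub_eq_zero.1 h] at this
  linarith

theorem circleLog_zero (θ : ℝ) : circleLog θ 0 = 0 := by simp [circleLog]

theorem circleLog_two_pi (z : ℂ) : circleLog (2 * Real.pi) z = circleLog 0 z := by
  simp [circleLog, Complex.exp_neg]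

theorem hasDerivAt_circleLog {z : ℂ} (hz : ‖z‖ < 1) (θ : ℝ) :
    HasDerivAt (circleLog θ) (-(1 / (Complex.exp (θ * Complex.I) - z))) z := by
  have h : HasDerivAt (fun z : ℂ => 1 - z * Complex.exp (-(θ * Complex.I)))
      (-(Complex.exp (-(θ * Complex.I)))) z := by
    simpa using ((hasDerivAt_id z).mul_const _).const_sub 1
  convert! h.clog (one_sub_mul_exp_mem_slitPlane hz θ) using 1
  have h1 := exp_sub_ne_zero hz θ
  have h2 := Complex.slitPlane_ne_zero (one_sub_mul_exp_mem_slitPlane hz θ)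
  have h3 := Complex.exp_ne_zero (θ * Complex.I)
  rw [Complex.exp_neg] at h2 ⊢
  rw [neg_div, neg_inj, div_eq_div_iff h1 h2]
  field_simp

/-- The Poisson kernel of the unit disk. -/
noncomputable def poissonKer (z : ℂ) (θ : ℝ) : ℝ :=
  (1 - ‖z‖ ^ 2) / ‖Complex.exp (θ * Complex.I) - z‖ ^ 2

/-- The kernel is 1 + 2 Re(z / (exp(iθ) - z)), and the second term is the θ-derivative of twice the
imaginary part of the logarithm. -/
theorem hasDerivAt_poissonKer_primitive {z : ℂ} (hz : ‖z‖ < 1) (θ : ℝ) :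
    HasDerivAt (fun θ : ℝ => θ + 2 * (circleLog θ z).im) (poissonKer z θ) θ := by
  have h1 : HasDerivAt (fun θ : ℝ => 1 - z * Complex.exp (-(θ * Complex.I)))
      (z * Complex.I * Complex.exp (-(θ * Complex.I))) θ := by
    have h : HasDerivAt (fun θ : ℝ => -((θ : ℂ) * Complex.I)) (-Complex.I) θ := by
      simpa using ((hasDerivAt_id θ).ofReal_comp.mul_const Complex.I).fun_neg
    convert! (h.cexp.const_mul z).const_sub 1 using 1
    ring
  have h2 := h1.clog_real (one_sub_mul_exp_mem_slitPlane hz θ)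
  have h3 := (Complex.imCLM.hasFDerivAt.comp_hasDerivAt θ h2)
  have h4 := (hasDerivAt_id θ).add (h3.const_mul 2)
  refine h4.congr_deriv ?_
  have h5 := exp_sub_ne_zero hz θ
  have h6 : z * Complex.I * Complex.exp (-(θ * Complex.I)) / (1 - z * Complex.exp (-(θ * Complex.I)))
      = z * Complex.I / (Complex.exp (θ * Complex.I) - z) := by
    have h2 := Complex.slitPlane_ne_zero (one_sub_mul_exp_mem_slitPlane hz θ)
    have h3 := Complex.exp_ne_zero (θ * Complex.I)
    rw [Complex.exp_neg] at h2 ⊢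
    rw [div_eq_div_iff h2 h5]
    field_simp
  rw [h6, poissonKer, Complex.imCLM_apply]
  set u := Complex.exp (θ * Complex.I) with hu
  have hu1 : Complex.normSq u = 1 := by
    rw [Complex.normSq_eq_norm_sq, hu, Complex.norm_exp_ofReal_mul_I]; norm_num
  have h7 : 0 < Complex.normSq (u - z) := Complex.normSq_pos.2 h5
  rw [← Complex.normSq_eq_norm_sq, ← Complex.normSq_eq_norm_sq, Complex.div_im, eq_div_iff h7.ne']
  have h8 : Complex.normSq (u - z) = (u.re - z.re) ^ 2 + (u.im - z.im) ^ 2 := by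
    simp [Complex.normSq_apply]; ring
  field_simp
  rw [h8]
  rw [Complex.normSq_apply] at hu1 ⊢
  simp
  linear_combination hu1

theorem continuous_poissonKer {z : ℂ} (hz : ‖z‖ < 1) : Continuous (poissonKer z) := by
  unfold poissonKer
  refine Continuous.div (by fun_prop) (by fun_prop) fun θ => ?_
  have := norm_pos_iff.2 (exp_sub_ne_zero hz θ)
  positivity

theorem poissonKer_nonneg {z : ℂ} (hz : ‖z‖ < 1) (θ : ℝ) : 0 ≤ poissonKer z θ := by
  have := norm_nonneg z
  exact div_nonneg (by nlinarith) (by positivity)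

/-- The harmonic measure of the arc from angle `α` to angle `β`, seen from `z`. -/
noncomputable def arcMeasure (α β : ℝ) (z : ℂ) : ℝ :=
  1 / (2 * Real.pi) * ∫ θ in α..β, poissonKer z θ

theorem arcMeasure_eq {z : ℂ} (hz : ‖z‖ < 1) (α β : ℝ) :
    arcMeasure α β z =
      1 / (2 * Real.pi) * ((β - α) + 2 * (circleLog β z - circleLog α z).im) := by
  rw [arcMeasure, intervalIntegral.integral_eq_sub_of_hasDerivAt
    (fun θ _ => hasDerivAt_poissonKer_primitive hz θ)
    ((continuous_poissonKer hz).intervalIntegrable _ _), Complex.sub_im]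
  ring

theorem arcMeasure_nonneg {z : ℂ} (hz : ‖z‖ < 1) {α β : ℝ} (h : α ≤ β) : 0 ≤ arcMeasure α β z :=
  mul_nonneg (by have := Real.pi_pos; positivity)
    (intervalIntegral.integral_nonneg h fun θ _ => poissonKer_nonneg hz θ)

theorem arcMeasure_add {z : ℂ} (hz : ‖z‖ < 1) (α β γ : ℝ) :
    arcMeasure α β z + arcMeasure β γ z = arcMeasure α γ z := by
  simp only [arcMeasure_eq hz, Complex.sub_im]; ring

theorem arcMeasure_full {z : ℂ} (hz : ‖z‖ < 1) : arcMeasure 0 (2 * Real.pi) z = 1 := by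
  rw [arcMeasure_eq hz, circleLog_two_pi]
  have := Real.pi_pos
  simp; field_simp

/-- The closed arc is compact, so it keeps a distance δ from ζ; for z within δ/2 of ζ the kernel on
it is at most (1 - |z|²) / (δ/2)². -/
theorem tendsto_arcMeasure_zero {ζ : ℂ} (hζ : ‖ζ‖ = 1) {α β : ℝ} (hαβ : α ≤ β)
    (h : ∀ θ ∈ Set.Icc α β, Complex.exp (θ * Complex.I) ≠ ζ) :
    Filter.Tendsto (arcMeasure α β) (nhdsWithin ζ (Metric.ball 0 1)) (nhds 0) := by
  obtain ⟨δ, hδ, hδθ⟩ : ∃ δ > 0, ∀ θ ∈ Set.Icc α β, δ ≤ ‖Complex.exp (θ * Complex.I) - ζ‖ := by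
    have hne : (Set.Icc α β).Nonempty := Set.nonempty_Icc.2 hαβ
    obtain ⟨x, hx, hmin⟩ := isCompact_Icc.exists_isMinOn hne
      (f := fun θ : ℝ => ‖Complex.exp (θ * Complex.I) - ζ‖) (by fun_prop)
    exact ⟨_, norm_pos_iff.2 (sub_ne_zero.2 (h x hx)), fun θ hθ => hmin hθ⟩
  have hpi := Real.pi_pos
  have hlim : Filter.Tendsto (fun z : ℂ => 1 / (2 * Real.pi) *
      (((1 - ‖z‖ ^ 2) / (δ / 2) ^ 2) * |β - α|)) (nhdsWithin ζ (Metric.ball 0 1)) (nhds 0) := by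
    have : Continuous (fun z : ℂ => 1 / (2 * Real.pi) *
      (((1 - ‖z‖ ^ 2) / (δ / 2) ^ 2) * |β - α|)) := by fun_prop
    have h0 := this.tendsto ζ
    simp only [hζ] at h0
    norm_num at h0
    refine Filter.Tendsto.mono_left ?_ nhdsWithin_le_nhds
    simpa using h0
  refine tendsto_of_tendsto_of_tendsto_of_le_of_le' tendsto_const_nhds hlim ?_ ?_
  · filter_upwards [self_mem_nhdsWithin] with z hz
    exact arcMeasure_nonneg (by simpa using hz) hαβ
  · filter_upwards [self_mem_nhdsWithin,
      mem_nhdsWithin_of_mem_nhds (Metric.ball_mem_nhds ζ (half_pos hδ))] with z hz hzζ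
    have hz : ‖z‖ < 1 := by simpa using hz
    rw [mem_ball_iff_norm] at hzζ
    unfold arcMeasure
    refine mul_le_mul_of_nonneg_left ?_ (by positivity)
    refine (le_abs_self _).trans ?_
    rw [← Real.norm_eq_abs]
    refine intervalIntegral.norm_integral_le_of_norm_le_const fun θ hθ => ?_
    rw [Set.uIoc_of_le hαβ] at hθ
    rw [Real.norm_of_nonneg (poissonKer_nonneg hz θ), poissonKer]
    have h1 := hδθ θ (Set.Ioc_subset_Icc_self hθ)
    have h2 : δ / 2 ≤ ‖Complex.exp (θ * Complex.I) - z‖ := by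
      have := norm_sub_le_norm_sub_add_norm_sub (Complex.exp (θ * Complex.I)) z ζ
      linarith
    have h3 : 0 ≤ 1 - ‖z‖ ^ 2 := by nlinarith [norm_nonneg z]
    gcongr

theorem poissonExtension_stepFunction (b₁ b₂ b₃ b₄ : ℂ) {p : ℝ} (hp : p ∈ Set.Ioo 0 Real.pi) {z : ℂ}
    (hz : ‖z‖ < 1) :
    poissonExtension (stepFunction b₁ b₂ b₃ b₄ p) z =
      arcMeasure 0 p z * b₄ + arcMeasure p Real.pi z * b₁ +
        arcMeasure Real.pi (Real.pi + p) z * b₂ +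
        arcMeasure (Real.pi + p) (2 * Real.pi) z * b₃ := by
  obtain ⟨hp0, hpi⟩ := hp
  -- Agreement on the open arc suffices, so the values at the jumps play no role.
  have piece : ∀ (α β : ℝ) (v : ℂ), α ≤ β →
      (∀ θ ∈ Set.Ioo α β, stepFunction b₁ b₂ b₃ b₄ p θ = v) →
      IntervalIntegrable (fun θ => ((poissonKer z θ : ℝ) : ℂ) * stepFunction b₁ b₂ b₃ b₄ p θ)
        MeasureTheory.volume α β ∧
      (1 / (2 * Real.pi) : ℝ) * ∫ θ in α..β, ((poissonKer z θ : ℝ) : ℂ) *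
        stepFunction b₁ b₂ b₃ b₄ p θ = arcMeasure α β z * v := by
    intro α β v hαβ hv
    have hc : Continuous (fun θ => ((poissonKer z θ : ℝ) : ℂ) * v) :=
      (Complex.continuous_ofReal.comp (continuous_poissonKer hz)).mul continuous_const
    have heq : ∀ θ ∈ Set.Ioo α β, ((poissonKer z θ : ℝ) : ℂ) * v =
        ((poissonKer z θ : ℝ) : ℂ) * stepFunction b₁ b₂ b₃ b₄ p θ := fun θ hθ => by rw [hv θ hθ]
    constructor
    · exact (hc.intervalIntegrable α β).congr_uIoo (by rwa [Set.uIoo_of_le hαβ])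
    · rw [← intervalIntegral.integral_congr_uIoo (f := fun θ => ((poissonKer z θ : ℝ) : ℂ) * v)
          (by rwa [Set.uIoo_of_le hαβ]),
        intervalIntegral.integral_mul_const, intervalIntegral.integral_ofReal, arcMeasure]
      push_cast; ring
  obtain ⟨i1, e1⟩ := piece 0 p b₄ hp0.le fun θ hθ => by simp [stepFunction, hθ.2]
  obtain ⟨i2, e2⟩ := piece p Real.pi b₁ hpi.le fun θ hθ => by
    simp [stepFunction, hθ.2, not_lt.2 hθ.1.le]
  obtain ⟨i3, e3⟩ := piece Real.pi (Real.pi + p) b₂ (by linarith) fun θ hθ => by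
    have : ¬ θ < p := by have := hθ.1; linarith
    simp [stepFunction, hθ.2, not_lt.2 hθ.1.le, this]
  obtain ⟨i4, e4⟩ := piece (Real.pi + p) (2 * Real.pi) b₃ (by linarith) fun θ hθ => by
    have h1 : ¬ θ < p := by have := hθ.1; linarith
    have h2 : ¬ θ < Real.pi := by have := hθ.1; linarith
    simp [stepFunction, not_lt.2 hθ.1.le, h1, h2]
  rw [← e1, ← e2, ← e3, ← e4, ← mul_add, ← mul_add, ← mul_add,
    intervalIntegral.integral_add_adjacent_intervals i1 i2,
    intervalIntegral.integral_add_adjacent_intervals (i1.trans i2) i3,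
    intervalIntegral.integral_add_adjacent_intervals ((i1.trans i2).trans i3) i4]
  rfl

/-! ### Perfect squares on the hyperbola -/

/-- The numerator of the derivative of the analytic part of the Poisson extension of the step
function with jumps at `1, w, -1, -w`. -/
def jumpNumerator (b₁ b₂ b₃ b₄ w z : ℂ) : ℂ :=
  (b₄ - b₃) * (1 + z) * (w ^ 2 - z ^ 2) + (b₁ - b₄) * (w + z) * (1 - z ^ 2) -
    (b₂ - b₁) * (1 - z) * (w ^ 2 - z ^ 2) - (b₃ - b₂) * (w - z) * (1 - z ^ 2)

/-- The z³ terms cancel because the jumps sum to zero; `e0`, `e1`, `e2` identify the three remaining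
coefficients with those of a square. Only j² = -1 is used and μ is arbitrary nonzero, so that the
same identity also serves the conjugated vertices. -/
theorem jumpNumerator_hyperbola {S T μ j : ℂ} (hj : j ^ 2 = -1) (hS : S ≠ 0) (hT : T ≠ 0)
    (hμ : μ ≠ 0) (hST : S - j * T ≠ 0) (z : ℂ) :
    jumpNumerator (-1) (j / 2 * (T ^ 2 / μ - μ / T ^ 2)) 1 (j / 2 * (S ^ 2 / μ - μ / S ^ 2))
        (((S + j * T) / (S - j * T)) ^ 2) z * (μ * (S * T) * (S - j * T) ^ 4) =
      -2 * (S ^ 2 - T ^ 2) *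
        ((S + j * T) * (μ + S * T) - z * (S - j * T) * (μ - S * T)) ^ 2 := by
  have hx : ∀ U : ℂ, U ≠ 0 → μ * U ^ 2 * (j / 2 * (U ^ 2 / μ - μ / U ^ 2)) =
      j / 2 * (U ^ 4 - μ ^ 2) := by
    intro U hU; field_simp
  have hw : (((S + j * T) / (S - j * T)) ^ 2) * (S - j * T) ^ 2 = (S + j * T) ^ 2 := by
    field_simp
  have h2 := hx T hT
  have h4 := hx S hS
  generalize j / 2 * (T ^ 2 / μ - μ / T ^ 2) = x2 at *
  generalize j / 2 * (S ^ 2 / μ - μ / S ^ 2) = x4 at *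
  generalize (((S + j * T) / (S - j * T)) ^ 2) = w at *
  have hD : μ * S ^ 2 * T ^ 2 * (x4 - x2) = j / 2 * (S ^ 2 - T ^ 2) * (S ^ 2 * T ^ 2 + μ ^ 2) := by
    linear_combination T ^ 2 * h4 - S ^ 2 * h2
  have hE : μ * S ^ 2 * T ^ 2 * (x4 + x2) = j / 2 * (S ^ 2 + T ^ 2) * (S ^ 2 * T ^ 2 - μ ^ 2) := by
    linear_combination T ^ 2 * h4 + S ^ 2 * h2
  have e0 : (w ^ 2 * (x4 - x2 - 2) - w * (x4 - x2 + 2)) * (μ * (S * T) ^ 2 * (S - j * T) ^ 4) =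
      -2 * (S ^ 2 - T ^ 2) * ((S + j * T) * (μ + S * T)) ^ 2 * (S * T) := by
    have : (w ^ 2 * (x4 - x2 - 2) - w * (x4 - x2 + 2)) * (μ * (S * T) ^ 2 * (S - j * T) ^ 4) =
        (w * (S - j * T) ^ 2) *
          ((w * (S - j * T) ^ 2) * (μ * S ^ 2 * T ^ 2 * (x4 - x2) - 2 * μ * S ^ 2 * T ^ 2) -
            (S - j * T) ^ 2 * (μ * S ^ 2 * T ^ 2 * (x4 - x2) + 2 * μ * S ^ 2 * T ^ 2)) := by ring
    rw [this, hw, hD]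
    linear_combination (S + j * T) ^ 2 * (2 * (S * T) * (S ^ 2 - T ^ 2) * ((S * T) ^ 2 + μ ^ 2) -
      4 * μ * (S * T) ^ 2 * T ^ 2) * hj
  have e1 : ((w ^ 2 - 1) * (x4 + x2)) * (μ * (S * T) ^ 2 * (S - j * T) ^ 4) =
      4 * (S ^ 2 - T ^ 2) * ((S + j * T) * (μ + S * T)) * ((S - j * T) * (μ - S * T)) * (S * T) := by
    have : ((w ^ 2 - 1) * (x4 + x2)) * (μ * (S * T) ^ 2 * (S - j * T) ^ 4) =
        ((w * (S - j * T) ^ 2) ^ 2 - (S - j * T) ^ 4) * (μ * S ^ 2 * T ^ 2 * (x4 + x2)) := by ring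
    rw [this, hw, hE]
    linear_combination 4 * (S * T) * ((S * T) ^ 2 - μ ^ 2) *
      (j ^ 2 * (S ^ 2 * T ^ 2 + T ^ 4) + (S ^ 4 - S ^ 2 * T ^ 2)) * hj
  have e2 : ((w - 1) * (x4 - x2) + 2 * (w + 1)) * (μ * (S * T) ^ 2 * (S - j * T) ^ 4) =
      -2 * (S ^ 2 - T ^ 2) * ((S - j * T) * (μ - S * T)) ^ 2 * (S * T) := by
    have : ((w - 1) * (x4 - x2) + 2 * (w + 1)) * (μ * (S * T) ^ 2 * (S - j * T) ^ 4) =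
        (S - j * T) ^ 2 * ((w * (S - j * T) ^ 2 - (S - j * T) ^ 2) * (μ * S ^ 2 * T ^ 2 * (x4 - x2)) +
          2 * (w * (S - j * T) ^ 2 + (S - j * T) ^ 2) * (μ * S ^ 2 * T ^ 2)) := by ring
    rw [this, hw, hD]
    linear_combination (S - j * T) ^ 2 * (2 * (S * T) * (S ^ 2 - T ^ 2) * ((S * T) ^ 2 + μ ^ 2) +
      4 * μ * (S * T) ^ 2 * T ^ 2) * hj
  apply mul_right_cancel₀ (mul_ne_zero hS hT)
  rw [jumpNumerator]
  linear_combination e0 + z * e1 + z ^ 2 * e2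

theorem jumpNumerator_affine (c d b₁ b₂ b₃ b₄ w z : ℂ) :
    jumpNumerator (c + d * b₁) (c + d * b₂) (c + d * b₃) (c + d * b₄) w z =
      d * jumpNumerator b₁ b₂ b₃ b₄ w z := by
  simp only [jumpNumerator]; ring

/-- The normalised point is sin(m + iτ), written with exponentials; this makes it rational in
exp(τ/2) and exp(im). -/
theorem hyperbolaPoint_eq (b₁ b₃ : ℂ) (m : ℝ) (τ : ℝ) :
    hyperbolaPoint b₁ b₃ m τ = (b₁ + b₃) / 2 + (b₃ - b₁) / 2 *
      (Complex.I / 2 * ((Real.exp (τ / 2) : ℂ) ^ 2 / Complex.exp (m * Complex.I) -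
        Complex.exp (m * Complex.I) / (Real.exp (τ / 2) : ℂ) ^ 2)) := by
  have h1 : (Real.exp (τ / 2) : ℂ) ^ 2 = Complex.exp τ := by
    rw [Complex.ofReal_exp, ← Complex.exp_nat_mul]; push_cast; ring_nf
  rw [hyperbolaPoint, h1]
  push_cast [Complex.ofReal_sin, Complex.ofReal_cos, Complex.ofReal_sinh, Complex.ofReal_cosh]
  rw [Complex.sin, Complex.cos, Complex.sinh, Complex.cosh, neg_mul, Complex.exp_neg,
    Complex.exp_neg]
  congr 2
  have h2 := Complex.exp_ne_zero τ
  have h3 := Complex.exp_ne_zero (m * Complex.I)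
  field_simp
  ring

theorem norm_ofReal_add_I_mul (a b : ℝ) : ‖(a : ℂ) + Complex.I * b‖ = √(a ^ 2 + b ^ 2) := by
  rw [mul_comm, Complex.norm_add_mul_I]

theorem conj_exp_ofReal_mul_I (m : ℝ) :
    conj (Complex.exp (m * Complex.I)) = (Complex.exp (m * Complex.I))⁻¹ := by
  rw [← Complex.exp_conj, ← Complex.exp_neg]; simp

/-! ### The constants p, X and z₀ -/

section Constants

variable {s t m : ℝ}

theorem exp_half_mul_exp_half (s t : ℝ) :
    (Real.exp ((s + t) / 2) : ℂ) = Real.exp (s / 2) * Real.exp (t / 2) := by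
  rw [add_div, Real.exp_add]; push_cast; rfl

theorem norm_one_add_exp_mul (r m : ℝ) :
    ‖1 + Complex.exp (m * Complex.I) * r‖ = √((1 + r * Real.cos m) ^ 2 + (r * Real.sin m) ^ 2) := by
  rw [← Complex.norm_add_mul_I]
  congr 1
  rw [Complex.exp_mul_I]; push_cast; ring

theorem norm_exp_add (r m : ℝ) :
    ‖Complex.exp (m * Complex.I) + r‖ = ‖1 + Complex.exp (m * Complex.I) * r‖ := by
  rw [norm_one_add_exp_mul, Complex.exp_mul_I]
  have : Complex.cos m + Complex.sin m * Complex.I + r =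
      ((Real.cos m + r : ℝ) : ℂ) + (Real.sin m : ℝ) * Complex.I := by push_cast; ring
  rw [this, Complex.norm_add_mul_I]
  congr 1
  linear_combination (1 - r ^ 2) * Real.sin_sq_add_cos_sq m

/-- For cos m > 0 the number r exp(im) lies in the right half-plane, hence closer to 1 than to -1.
This is the source of |z₀| < 1. -/
theorem norm_one_sub_lt (hm : 0 < Real.cos m) {r : ℝ} (hr : 0 < r) :
    ‖1 - Complex.exp (m * Complex.I) * r‖ < ‖1 + Complex.exp (m * Complex.I) * r‖ := by
  have := norm_one_add_exp_mul (-r) m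
  rw [norm_one_add_exp_mul, show (1 : ℂ) - Complex.exp (m * Complex.I) * r =
      1 + Complex.exp (m * Complex.I) * (-r : ℝ)
    by push_cast; ring, this]
  apply Real.sqrt_lt_sqrt (by positivity)
  nlinarith [mul_pos hr hm]

theorem norm_sub_I_mul (a b : ℝ) : ‖(a : ℂ) - Complex.I * b‖ = ‖(a : ℂ) + Complex.I * b‖ := by
  have := norm_ofReal_add_I_mul a (-b)
  rw [norm_ofReal_add_I_mul, show (a : ℂ) - Complex.I * b = a + Complex.I * (-b : ℝ) by
    push_cast; ring, this]
  norm_num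

theorem norm_I_mul_add (a b : ℝ) : ‖Complex.I * a + (b : ℂ)‖ = ‖(a : ℂ) + Complex.I * b‖ := by
  rw [← norm_sub_I_mul, show Complex.I * a + (b : ℂ) = Complex.I * (a - Complex.I * b) by
    linear_combination (b : ℂ) * Complex.I_sq, norm_mul, Complex.norm_I, one_mul]

theorem ofReal_add_I_mul_ne_zero {a : ℝ} (ha : 0 < a) (b : ℝ) : (a : ℂ) + Complex.I * b ≠ 0 := by
  intro h
  have := congrArg Complex.re h
  simp at this
  exact ha.ne' this

theorem norm_hyperbolaRotation (hm : 0 < Real.cos m) {b₁ b₃ : ℂ} (hb : b₁ ≠ b₃) :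
    ‖conj (b₃ - b₁) / (‖b₃ - b₁‖ : ℂ) *
          (((Complex.I * Real.exp (s / 2) + Real.exp (t / 2)) *
              (1 + Complex.exp (m * Complex.I) * Real.exp ((s + t) / 2))) /
            ((Real.exp (s / 2) + Complex.I * Real.exp (t / 2)) *
              (Complex.exp (m * Complex.I) + Real.exp ((s + t) / 2))))‖ = 1 := by
  have h1 := norm_one_sub_lt hm (Real.exp_pos ((s + t) / 2))
  have h2 := ofReal_add_I_mul_ne_zero (Real.exp_pos (s / 2)) (Real.exp (t / 2))
  have h3 : ‖b₃ - b₁‖ ≠ 0 := norm_ne_zero_iff.2 (sub_ne_zero.2 hb.symm)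
  have h4 := (norm_nonneg _).trans_lt h1
  have h5 := norm_ne_zero_iff.2 h2
  rw [norm_mul, norm_div, norm_div, norm_mul, norm_mul, norm_exp_add, norm_I_mul_add,
    Complex.norm_conj, Complex.norm_real, norm_norm, div_self h3, div_self (mul_ne_zero h5 h4.ne'), one_mul]

theorem norm_hyperbolaCenter_lt (hm : 0 < Real.cos m) :
    ‖((Real.exp (s / 2) + Complex.I * Real.exp (t / 2)) *
              (1 - Complex.exp (m * Complex.I) * Real.exp ((s + t) / 2))) /
            ((Real.exp (s / 2) - Complex.I * Real.exp (t / 2)) *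
              (1 + Complex.exp (m * Complex.I) * Real.exp ((s + t) / 2)))‖ < 1 := by
  have h1 := norm_one_sub_lt hm (Real.exp_pos ((s + t) / 2))
  have h2 := ofReal_add_I_mul_ne_zero (Real.exp_pos (s / 2)) (Real.exp (t / 2))
  have h4 := (norm_nonneg _).trans_lt h1
  have h5 := norm_pos_iff.2 h2
  rw [norm_div, norm_mul, norm_mul, norm_sub_I_mul, mul_div_mul_left _ _ h5.ne', div_lt_one h4]
  exact h1

theorem arccos_argument_mem (hst : t < s) :
    1 - 4 / (1 + Real.cosh (s - t)) ∈ Set.Ioo (-1 : ℝ) 1 := by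
  have h : 1 < Real.cosh (s - t) := Real.one_lt_cosh.2 (sub_ne_zero.2 hst.ne')
  have h1 : 4 / (1 + Real.cosh (s - t)) < 2 := by rw [div_lt_iff₀ (by linarith)]; linarith
  have h2 : 0 < 4 / (1 + Real.cosh (s - t)) := by positivity
  constructor <;> linarith

theorem arccos_mem_Ioo {x : ℝ} (hx : x ∈ Set.Ioo (-1 : ℝ) 1) :
    Real.arccos x ∈ Set.Ioo 0 Real.pi := by
  refine ⟨Real.arccos_pos.2 hx.2, lt_of_le_of_ne (Real.arccos_le_pi _) fun h => ?_⟩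
  rw [Real.arccos_eq_pi] at h
  linarith [hx.1]

/-- With S = exp(s/2) and T = exp(t/2), this says p = 4 arctan(T/S). It is checked on cosine and
sine, where T < S fixes the sign of the sine. -/
theorem exp_arccos_eq (hst : t < s) :
    Complex.exp (Real.arccos (1 - 4 / (1 + Real.cosh (s - t))) * Complex.I) =
      ((Real.exp (s / 2) + Complex.I * Real.exp (t / 2)) /
        (Real.exp (s / 2) - Complex.I * Real.exp (t / 2))) ^ 2 := by
  have hx := arccos_argument_mem hst
  set S := Real.exp (s / 2) with hS
  set T := Real.exp (t / 2) with hT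
  have hS0 : 0 < S := Real.exp_pos _
  have hT0 : 0 < T := Real.exp_pos _
  have hTS : T < S := Real.exp_lt_exp.2 (by linarith)
  have hcosh : Real.cosh (s - t) = (S ^ 4 + T ^ 4) / (2 * S ^ 2 * T ^ 2) := by
    have e1 : Real.exp (s - t) = S ^ 2 / T ^ 2 := by
      rw [Real.exp_sub, hS, hT, ← Real.exp_nat_mul, ← Real.exp_nat_mul]; push_cast; ring_nf
    rw [Real.cosh_eq, Real.exp_neg, e1]
    field_simp
  have hre : 1 - 4 / (1 + Real.cosh (s - t)) =
      ((S ^ 2 - T ^ 2) ^ 2 - (2 * S * T) ^ 2) / (S ^ 2 + T ^ 2) ^ 2 := by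
    rw [hcosh]
    have : 1 + (S ^ 4 + T ^ 4) / (2 * S ^ 2 * T ^ 2) =
        (S ^ 2 + T ^ 2) ^ 2 / (2 * S ^ 2 * T ^ 2) := by
      field_simp; ring
    rw [this]
    field_simp; ring
  have him : Real.sin (Real.arccos (1 - 4 / (1 + Real.cosh (s - t)))) =
      4 * (S ^ 2 - T ^ 2) * (S * T) / (S ^ 2 + T ^ 2) ^ 2 := by
    rw [Real.sin_arccos, hre, Real.sqrt_eq_iff_mul_self_eq_of_pos]
    · field_simp; ring
    · have : 0 < S ^ 2 - T ^ 2 := by nlinarith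
      positivity
  rw [Complex.exp_mul_I, ← Complex.ofReal_cos, ← Complex.ofReal_sin, him,
    Real.cos_arccos hx.1.le hx.2.le, hre]
  have h1 := ofReal_add_I_mul_ne_zero hS0 T
  have h2 : (S : ℂ) - Complex.I * T ≠ 0 := by
    have := ofReal_add_I_mul_ne_zero hS0 (-T)
    push_cast at this; rwa [mul_neg, ← sub_eq_add_neg] at this
  have h3 : (S : ℂ) ^ 2 + T ^ 2 = (S + Complex.I * T) * (S - Complex.I * T) := by
    linear_combination (T : ℂ) ^ 2 * Complex.I_sq
  have h4 : ((S : ℂ) ^ 2 - T ^ 2) ^ 2 - (2 * S * T) ^ 2 + 4 * (S ^ 2 - T ^ 2) * (S * T) * Complex.I =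
      (S + Complex.I * T) ^ 4 := by
    linear_combination -(4 * (S * T) ^ 2 + 2 * (S ^ 2 - T ^ 2 + 2 * Complex.I * (S * T)) * T ^ 2 +
      (Complex.I ^ 2 + 1) * T ^ 4 : ℂ) * Complex.I_sq
  push_cast
  rw [h3, div_mul_eq_mul_div, ← add_div, h4]
  field_simp

end Constants

/-! ### Proper local homeomorphisms and global inverses -/

/-- A proper local homeomorphism from a connected space onto a simply connected one is bijective. -/
theorem IsLocalHomeomorph.bijective_of_isProperMap {E X : Type*} [TopologicalSpace E]
    [TopologicalSpace X] [T2Space E] [T1Space X] [ConnectedSpace E] [SimplyConnectedSpace X]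
    [LocallyPathConnectedSpace X] {f : E → X} (hf : IsLocalHomeomorph f) (hp : IsProperMap f) :
    Function.Bijective f := by
  have hcov : IsCoveringMap f := by
    rw [isCoveringMap_iff_isCoveringMapOn_univ]
    refine IsClosedMap.isCoveringMapOn_of_isLocalHomeomorphOn hp.isClosedMap (fun x _ => ?_)
      (by simpa [← isLocalHomeomorph_iff_isLocalHomeomorphOn_univ] using hf)
    -- Fibres are compact by properness and discrete by local injectivity, hence finite.
    refine (hp.isCompact_preimage isCompact_singleton).finite
      (.of_openPartialHomeomorph f subset_rfl fun e _ => ?_)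
    obtain ⟨φ, hφ, h⟩ := hf e
    exact ⟨φ, hφ, h.symm⟩
  obtain ⟨e₀⟩ : Nonempty E := inferInstance
  -- The identity of the simply connected base lifts to a section k. Then k ∘ f and the identity are
  -- lifts of f agreeing at e₀, so they coincide on the connected space E.
  obtain ⟨k, ⟨hk0, hk⟩, -⟩ :=
    hcov.existsUnique_continuousMap_lifts (ContinuousMap.id X) (f e₀) e₀ rfl
  have hleft : (k : X → E) ∘ f = id :=
    hcov.eq_of_comp_eq (k.continuous.comp hp.continuous) continuous_id
      (by rw [← Function.comp_assoc, hk]; rfl) e₀ (by simpa using hk0)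
  exact ⟨Function.LeftInverse.injective (g := k) (congrFun hleft),
    Function.RightInverse.surjective (g := k) (congrFun hk)⟩

/-- A local diffeomorphism of the disk all of whose boundary cluster values lie on the boundary of
a bounded star-shaped domain maps the disk bijectively onto that domain. -/
theorem IsCenteredGauge.bijOn_ball {B : Set ℂ} {c : ℂ} {G : ℂ → ℝ} (hG : IsCenteredGauge B c G)
    {f : ℂ → ℂ} (hfc : ContinuousOn f (Metric.ball 0 1))
    (hloc : IsLocalHomeomorphOn f (Metric.ball 0 1))
    (hcpt : ∀ A : Set ℂ, IsClosed A → Disjoint A B → IsCompact (Metric.ball 0 1 ∩ f ⁻¹' A)) :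
    Set.BijOn f (Metric.ball 0 1) {z | G z < 1} := by
  set D : Set ℂ := Metric.ball 0 1 with hD
  set Q : Set ℂ := {z | G z < 1} with hQ
  have hDo : IsOpen D := Metric.isOpen_ball
  have hQo : IsOpen Q := isOpen_lt hG.continuous continuous_const
  have hopen : ∀ z ∈ D, Filter.map f (nhds z) = nhds (f z) := fun z hz => hloc.map_nhds_eq hz
  -- values of larger gauge are taken near a point where the gauge is positive
  have hgrow : ∀ z ∈ D, 0 < G (f z) → ∃ y ∈ D, G (f z) < G (f y) := by
    intro z hz hpos
    have hcont : Filter.Tendsto (fun l : ℝ => c + l * (f z - c)) (nhdsWithin 1 (Set.Ioi 1))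
        (nhds (f z)) := by
      have : Continuous (fun l : ℝ => c + l * (f z - c)) := by fun_prop
      have h := this.tendsto 1
      simp only [Complex.ofReal_one, one_mul, add_sub_cancel] at h
      exact h.mono_left nhdsWithin_le_nhds
    have himg : f '' D ∈ nhds (f z) := by
      rw [← hopen z hz]
      exact Filter.image_mem_map (hDo.mem_nhds hz)
    obtain ⟨l, ⟨y, hy, hyl⟩, hl⟩ := ((hcont.eventually himg).and self_mem_nhdsWithin).exists
    have hl : 1 < l := hl
    refine ⟨y, hy, ?_⟩
    rw [hyl, hG.homogeneous l _ (by linarith)]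
    nlinarith
  -- Maximum principle: a value of gauge at least 1 yields one of gauge r > 1. The set {G ≥ r}
  -- misses B, so its preimage is compact and G ∘ f attains a maximum there, which openness
  -- contradicts.
  have hmaps : Set.MapsTo f D Q := by
    intro z hz
    by_contra hcon
    have hcon : 1 ≤ G (f z) := not_lt.1 hcon
    obtain ⟨y, hy, hzy⟩ := hgrow z hz (by linarith)
    have hK := hcpt {w | G (f y) ≤ G w} (isClosed_le continuous_const hG.continuous) (by
      rw [Set.disjoint_left, hG.boundary_eq]
      intro w hw hw1
      have hw : G (f y) ≤ G w := hw
      have hw1 : G w = 1 := hw1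
      linarith)
    obtain ⟨x, ⟨hxD, hx⟩, hmax⟩ := hK.exists_isMaxOn (f := fun w => G (f w))
      ⟨y, hy, (le_rfl : G (f y) ≤ G (f y))⟩
      (hG.continuous.comp_continuousOn (hfc.mono Set.inter_subset_left))
    have hx : G (f y) ≤ G (f x) := hx
    obtain ⟨x', hx', hlt⟩ := hgrow x hxD (by linarith)
    have := hmax (⟨hx', (hx.trans hlt.le : G (f y) ≤ G (f x'))⟩ :
      x' ∈ D ∩ f ⁻¹' {w | G (f y) ≤ G w})
    exact absurd hlt (not_lt.2 this)
  have : ConnectedSpace D := isConnected_iff_connectedSpace.1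
    ((convex_ball (0 : ℂ) 1).isConnected ⟨0, by simp⟩)
  have : ContractibleSpace Q := hG.starConvex.contractibleSpace ⟨c, by simp [hG.apply_center]⟩
  have : LocallyPathConnectedSpace Q := hQo.locallyPathConnectedSpace
  set F : D → Q := hmaps.restrict f D Q with hF
  have hFc : Continuous F := hfc.mapsToRestrict hmaps
  have hFloc : IsLocalHomeomorph F := by
    have h1 : IsLocalHomeomorph ((↑) : Q → ℂ) := hQo.isOpenEmbedding_subtypeVal.isLocalHomeomorph
    refine IsLocalHomeomorph.of_comp (g := ((↑) : Q → ℂ)) ?_ h1 hFc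
    have h2 : IsLocalHomeomorph ((↑) : D → ℂ) := hDo.isOpenEmbedding_subtypeVal.isLocalHomeomorph
    rw [isLocalHomeomorph_iff_isLocalHomeomorphOn_univ] at h2 ⊢
    exact IsLocalHomeomorphOn.comp (g := f) (t := D) hloc h2 (fun x _ => x.2)
  have hFp : IsProperMap F := by
    have : LocallyCompactSpace Q := hQo.locallyCompactSpace
    rw [isProperMap_iff_isCompact_preimage]
    refine ⟨hFc, fun K hK => ?_⟩
    have hK' : IsCompact ((↑) '' K : Set ℂ) := hK.image continuous_subtype_val
    have h := hcpt _ hK'.isClosed (by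
      rw [Set.disjoint_left, hG.boundary_eq]
      rintro _ ⟨w, -, rfl⟩ hw1
      have h1 : G w < 1 := w.2
      have h2 : G w = 1 := hw1
      linarith)
    rw [Subtype.isCompact_iff]
    convert h using 1
    ext z
    simp only [Set.mem_image, Set.mem_preimage, Set.mem_inter_iff, Subtype.exists, exists_and_right,
      exists_eq_right]
    constructor
    · rintro ⟨hz, hzK⟩
      exact ⟨hz, hmaps hz, hzK⟩
    · rintro ⟨hz, h1, h2⟩
      exact ⟨hz, h2⟩
  have hbij := hFloc.bijective_of_isProperMap hFp
  refine ⟨hmaps, fun x hx y hy hxy => ?_, fun w hw => ?_⟩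
  · exact congrArg Subtype.val (hbij.1 (a₁ := ⟨x, hx⟩) (a₂ := ⟨y, hy⟩) (Subtype.ext hxy))
  · obtain ⟨z, hz⟩ := hbij.2 ⟨w, hw⟩
    exact ⟨z, z.2, congrArg Subtype.val hz⟩

theorem IsSensePreservingOn.exists_openPartialHomeomorph {f : ℂ → ℂ} {U : Set ℂ} (hU : IsOpen U)
    (hf : ContDiffOn ℝ ∞ f U) (hs : IsSensePreservingOn f U) {z : ℂ} (hz : z ∈ U) :
    ∃ φ : OpenPartialHomeomorph ℂ ℂ, z ∈ φ.source ∧ f = φ ∧ ContDiffAt ℝ ∞ φ.symm (f z) := by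
  have hfz : ContDiffAt ℝ ∞ f z := hf.contDiffAt (hU.mem_nhds hz)
  let L := (fderiv ℝ f z).toContinuousLinearEquivOfDetNeZero (hs z hz).2.ne'
  have hL : HasFDerivAt f (L : ℂ →L[ℝ] ℂ) z := by
    rw [ContinuousLinearMap.coe_toContinuousLinearEquivOfDetNeZero]
    exact (hs z hz).1.hasFDerivAt
  exact ⟨hfz.toOpenPartialHomeomorph f hL (by simp), hfz.mem_toOpenPartialHomeomorph_source hL _,
    (hfz.toOpenPartialHomeomorph_coe hL _).symm, hfz.to_localInverse hL (by simp)⟩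

theorem IsSensePreservingOn.isLocalHomeomorphOn {f : ℂ → ℂ} {U : Set ℂ} (hU : IsOpen U)
    (hf : ContDiffOn ℝ ∞ f U) (hs : IsSensePreservingOn f U) : IsLocalHomeomorphOn f U :=
  fun _ hz =>
    let ⟨φ, h1, h2, _⟩ := hs.exists_openPartialHomeomorph hU hf hz
    ⟨φ, h1, h2⟩

/-- By injectivity the global inverse agrees near each image point with the smooth inverse supplied
by the inverse function theorem. -/
theorem IsSensePreservingOn.isDiffeoOnto {f : ℂ → ℂ} {U V : Set ℂ} (hU : IsOpen U) (hV : IsOpen V)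
    (hf : ContDiffOn ℝ ∞ f U) (hs : IsSensePreservingOn f U) (hbij : Set.BijOn f U V) :
    IsDiffeoOnto f U V := by
  refine ⟨hU, hV, hbij, hf, Function.invFunOn f U, ?_, fun z hz => hbij.injOn.leftInvOn_invFunOn hz⟩
  intro w hw
  obtain ⟨z, hz, rfl⟩ := hbij.surjOn hw
  obtain ⟨φ, h1, h2, h3⟩ := hs.exists_openPartialHomeomorph hU hf hz
  refine (h3.congr_of_eventuallyEq ?_).contDiffWithinAt
  have hz' : φ.symm (f z) = z := by rw [h2]; exact φ.left_inv h1
  have hmem : ∀ᶠ y in nhds (f z), φ.symm y ∈ U := by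
    have := h3.continuousAt.tendsto
    rw [hz'] at this
    exact this (hU.mem_nhds hz)
  have htgt : ∀ᶠ y in nhds (f z), y ∈ φ.target :=
    φ.open_target.mem_nhds (by rw [h2]; exact φ.map_source h1)
  filter_upwards [hmem, htgt] with y hy hyt
  have : f (φ.symm y) = y := by rw [h2]; exact φ.right_inv hyt
  calc Function.invFunOn f U y = Function.invFunOn f U (f (φ.symm y)) := by rw [this]
    _ = φ.symm y := hbij.injOn.leftInvOn_invFunOn hy

/-! ### Cluster values on the unit circle -/

theorem mem_segment_of_tendsto_combination {α : Type*} {l : Filter α} [l.NeBot]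
    {ω₁ ω₂ ω₃ ω₄ : α → ℝ} {a₁ a₂ a₃ a₄ y : ℂ}
    (hpos : ∀ᶠ z in l, 0 ≤ ω₁ z ∧ 0 ≤ ω₂ z ∧ 0 ≤ ω₃ z ∧ 0 ≤ ω₄ z)
    (hsum : ∀ᶠ z in l, ω₁ z + ω₂ z + ω₃ z + ω₄ z = 1)
    (h₃ : Filter.Tendsto ω₃ l (nhds 0)) (h₄ : Filter.Tendsto ω₄ l (nhds 0))
    (hf : Filter.Tendsto (fun z => ω₁ z * a₁ + ω₂ z * a₂ + ω₃ z * a₃ + ω₄ z * a₄) l (nhds y)) :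
    y ∈ segment ℝ a₁ a₂ := by
  have hcl : IsClosed (segment ℝ a₁ a₂) := by
    rw [← convexHull_pair]
    exact Set.Finite.isClosed_convexHull ℝ (Set.toFinite _)
  have h3 : Filter.Tendsto (fun z => (ω₃ z : ℂ)) l (nhds 0) := by
    simpa [Function.comp_def] using (Complex.continuous_ofReal.tendsto 0).comp h₃
  have h4 : Filter.Tendsto (fun z => (ω₄ z : ℂ)) l (nhds 0) := by
    simpa [Function.comp_def] using (Complex.continuous_ofReal.tendsto 0).comp h₄
  -- Transferring the two vanishing weights to a₁ leaves the limit unchanged and produces points of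
  -- the closed segment.
  have hlim := (hf.add (h3.mul_const (a₁ - a₃))).add (h4.mul_const (a₁ - a₄))
  simp only [zero_mul, add_zero] at hlim
  refine hcl.mem_of_tendsto hlim ?_
  filter_upwards [hpos, hsum] with z ⟨p1, p2, p3, p4⟩ hs
  refine ⟨ω₁ z + ω₃ z + ω₄ z, ω₂ z, by positivity, p2, by linarith, ?_⟩
  simp only [Complex.real_smul]; push_cast; ring

section StepFunction

variable {b₁ b₂ b₃ b₄ : ℂ} {p : ℝ}

theorem arcMeasure_sum {z : ℂ} (hz : ‖z‖ < 1) (p : ℝ) :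
    arcMeasure 0 p z + arcMeasure p Real.pi z + arcMeasure Real.pi (Real.pi + p) z +
      arcMeasure (Real.pi + p) (2 * Real.pi) z = 1 := by
  rw [arcMeasure_add hz, arcMeasure_add hz, arcMeasure_add hz, arcMeasure_full hz]

theorem arcMeasure_pieces_nonneg {z : ℂ} (hz : ‖z‖ < 1) (hp : p ∈ Set.Ioo 0 Real.pi) :
    0 ≤ arcMeasure 0 p z ∧ 0 ≤ arcMeasure p Real.pi z ∧
      0 ≤ arcMeasure Real.pi (Real.pi + p) z ∧
      0 ≤ arcMeasure (Real.pi + p) (2 * Real.pi) z :=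
  ⟨arcMeasure_nonneg hz hp.1.le, arcMeasure_nonneg hz hp.2.le,
    arcMeasure_nonneg hz (by linarith [hp.1]), arcMeasure_nonneg hz (by linarith [hp.2])⟩

theorem norm_poissonExtension_stepFunction_le (hp : p ∈ Set.Ioo 0 Real.pi) {z : ℂ} (hz : ‖z‖ < 1) :
    ‖poissonExtension (stepFunction b₁ b₂ b₃ b₄ p) z‖ ≤ ‖b₁‖ + ‖b₂‖ + ‖b₃‖ + ‖b₄‖ := by
  obtain ⟨h1, h2, h3, h4⟩ := arcMeasure_pieces_nonneg hz hp
  have hs := arcMeasure_sum hz p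
  rw [poissonExtension_stepFunction _ _ _ _ hp hz]
  have key : ∀ (x : ℝ) (b : ℂ), 0 ≤ x → x ≤ 1 → ‖(x : ℂ) * b‖ ≤ ‖b‖ := by
    intro x b h0 h1
    rw [norm_mul, Complex.norm_real, Real.norm_of_nonneg h0]
    exact mul_le_of_le_one_left (norm_nonneg b) h1
  refine (norm_add_le_of_le (norm_add_le_of_le (norm_add_le_of_le (key _ _ h1 (by linarith))
    (key _ _ h2 (by linarith))) (key _ _ h3 (by linarith))) (key _ _ h4 (by linarith))).trans
    (le_of_eq (by ring))

theorem mem_quadBoundary_of_tendsto (hp : p ∈ Set.Ioo 0 Real.pi) {ζ y : ℂ} (hζ : ‖ζ‖ = 1)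
    {l : Filter ℂ} [l.NeBot] (hl : l ≤ nhdsWithin ζ (Metric.ball 0 1))
    (hy : Filter.Tendsto (poissonExtension (stepFunction b₁ b₂ b₃ b₄ p)) l (nhds y)) :
    y ∈ quadBoundary b₁ b₂ b₃ b₄ := by
  obtain ⟨hp0, hpi⟩ := hp
  have hball : ∀ᶠ z in l, ‖z‖ < 1 := by
    have : ∀ᶠ z in nhdsWithin ζ (Metric.ball 0 1), ‖z‖ < 1 := by
      filter_upwards [self_mem_nhdsWithin] with z hz
      simpa using hz
    exact hl this
  have hpos := hball.mono fun z hz => arcMeasure_pieces_nonneg hz ⟨hp0, hpi⟩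
  have hsum := hball.mono fun z hz => arcMeasure_sum hz p
  have hy' := hy.congr' (hball.mono fun z hz =>
    poissonExtension_stepFunction b₁ b₂ b₃ b₄ ⟨hp0, hpi⟩ hz)
  have vanish : ∀ {α β : ℝ}, α ≤ β → (∀ θ ∈ Set.Icc α β, Complex.exp (θ * Complex.I) ≠ ζ) →
      Filter.Tendsto (arcMeasure α β) l (nhds 0) := fun h1 h2 =>
    (tendsto_arcMeasure_zero hζ h1 h2).mono_left hl
  have im_exp : ∀ θ : ℝ, (Complex.exp (θ * Complex.I)).im = Real.sin θ :=
    Complex.exp_ofReal_mul_I_im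
  have re_exp : ∀ θ : ℝ, (Complex.exp (θ * Complex.I)).re = Real.cos θ :=
    Complex.exp_ofReal_mul_I_re
  have cos_ne_one : ∀ θ : ℝ, 0 < θ → θ < 2 * Real.pi → Real.cos θ ≠ 1 := by
    intro θ h0 h1 h
    have := (Real.cos_eq_one_iff_of_lt_of_lt (by linarith) h1).1 h
    linarith
  -- In each case two neighbouring arcs have closures missing ζ: the opposite half-circle if Im ζ ≠
  -- 0, the two arcs not ending at ζ if ζ = ±1. The jumps at ±exp(ip) need no separate case.
  rcases lt_trichotomy ζ.im 0 with him | him | him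
  · have hne : ∀ θ ∈ Set.Icc 0 Real.pi, Complex.exp (θ * Complex.I) ≠ ζ := by
      rintro θ ⟨h0, h1⟩ rfl
      rw [im_exp] at him
      exact absurd (Real.sin_nonneg_of_nonneg_of_le_pi h0 h1) (not_le.2 him)
    have h1 := vanish hp0.le fun θ hθ => hne θ ⟨hθ.1, hθ.2.trans hpi.le⟩
    have h2 := vanish hpi.le fun θ hθ => hne θ ⟨hp0.le.trans hθ.1, hθ.2⟩
    have := mem_segment_of_tendsto_combination (a₁ := b₂) (a₂ := b₃) (a₃ := b₄) (a₄ := b₁)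
      (hpos.mono fun z h => ⟨h.2.2.1, h.2.2.2, h.1, h.2.1⟩)
      (hsum.mono fun z h => by linarith) h1 h2 (hy'.congr fun z => by ring)
    simp [quadBoundary, this]
  · have hre : ζ.re = 1 ∨ ζ.re = -1 := by
      have h := Complex.sq_norm ζ
      rw [hζ, Complex.normSq_apply, him] at h
      rw [← sq_eq_one_iff]
      nlinarith
    rcases hre with hre | hre
    · have hne : ∀ θ ∈ Set.Icc p (Real.pi + p), Complex.exp (θ * Complex.I) ≠ ζ := by
        rintro θ ⟨h0, h1⟩ rfl
        rw [re_exp] at hre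
        exact cos_ne_one θ (by linarith) (by linarith) hre
      have h1 := vanish hpi.le fun θ hθ => hne θ ⟨hθ.1, by linarith [hθ.2]⟩
      have h2 := vanish (by linarith : Real.pi ≤ Real.pi + p)
        fun θ hθ => hne θ ⟨by linarith [hθ.1], hθ.2⟩
      have := mem_segment_of_tendsto_combination (a₁ := b₃) (a₂ := b₄) (a₃ := b₁) (a₄ := b₂)
        (hpos.mono fun z h => ⟨h.2.2.2, h.1, h.2.1, h.2.2.1⟩)
        (hsum.mono fun z h => by linarith) h1 h2 (hy'.congr fun z => by ring)
      simp [quadBoundary, this]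
    · have hne : ∀ θ : ℝ, Real.cos (θ - Real.pi) ≠ 1 → Complex.exp (θ * Complex.I) ≠ ζ := by
        rintro θ h rfl
        rw [re_exp] at hre
        rw [Real.cos_sub_pi, hre] at h
        norm_num at h
      have h1 := vanish hp0.le fun θ hθ => hne θ (by
        rw [← Real.cos_neg]
        exact cos_ne_one _ (by linarith [hθ.2]) (by linarith [hθ.1]))
      have h2 := vanish (by linarith : Real.pi + p ≤ 2 * Real.pi)
        fun θ hθ => hne θ (cos_ne_one _ (by linarith [hθ.1]) (by linarith [hθ.2]))
      have := mem_segment_of_tendsto_combination (a₁ := b₁) (a₂ := b₂) (a₃ := b₄) (a₄ := b₃)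
        (hpos.mono fun z h => ⟨h.2.1, h.2.2.1, h.1, h.2.2.2⟩)
        (hsum.mono fun z h => by linarith) h1 h2 (hy'.congr fun z => by ring)
      simp [quadBoundary, this]
  · have hne : ∀ θ ∈ Set.Icc Real.pi (2 * Real.pi), Complex.exp (θ * Complex.I) ≠ ζ := by
      rintro θ ⟨h0, h1⟩ rfl
      rw [im_exp] at him
      have : Real.sin (2 * Real.pi - θ) = -Real.sin θ := Real.sin_two_pi_sub θ
      have := Real.sin_nonneg_of_nonneg_of_le_pi (x := 2 * Real.pi - θ) (by linarith) (by linarith)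
      linarith
    have h1 := vanish (by linarith : Real.pi ≤ Real.pi + p)
      fun θ hθ => hne θ ⟨hθ.1, by linarith [hθ.2]⟩
    have h2 := vanish (by linarith : Real.pi + p ≤ 2 * Real.pi)
      fun θ hθ => hne θ ⟨by linarith [hθ.1], hθ.2⟩
    have := mem_segment_of_tendsto_combination (a₁ := b₄) (a₂ := b₁) (a₃ := b₂) (a₄ := b₃)
      hpos hsum h1 h2 hy'
    simp [quadBoundary, this]

/-- Only closedness is at issue. Along an ultrafilter tending to a closure point ζ, the bounded
values of f converge to some y in A; if |ζ| = 1, then y would lie on the quadrilateral's boundary.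
-/
theorem isCompact_ball_inter_preimage (hp : p ∈ Set.Ioo 0 Real.pi)
    (hc : ContinuousOn (poissonExtension (stepFunction b₁ b₂ b₃ b₄ p)) (Metric.ball 0 1))
    {A : Set ℂ} (hA : IsClosed A) (hd : Disjoint A (quadBoundary b₁ b₂ b₃ b₄)) :
    IsCompact (Metric.ball 0 1 ∩ poissonExtension (stepFunction b₁ b₂ b₃ b₄ p) ⁻¹' A) := by
  set f := poissonExtension (stepFunction b₁ b₂ b₃ b₄ p) with hf
  refine Metric.isCompact_of_isClosed_isBounded (isClosed_of_closure_subset fun ζ hζ => ?_)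
    (Metric.isBounded_ball.subset Set.inter_subset_left)
  have hne : (nhdsWithin ζ (Metric.ball 0 1 ∩ f ⁻¹' A)).NeBot :=
    mem_closure_iff_nhdsWithin_neBot.1 hζ
  set U : Filter ℂ := ↑(Ultrafilter.of (nhdsWithin ζ (Metric.ball 0 1 ∩ f ⁻¹' A))) with hU
  have hUle : U ≤ nhdsWithin ζ (Metric.ball 0 1 ∩ f ⁻¹' A) := Ultrafilter.of_le _
  have hUball : U ≤ nhdsWithin ζ (Metric.ball 0 1) :=
    hUle.trans (nhdsWithin_mono _ Set.inter_subset_left)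
  have hUmem : Metric.ball 0 1 ∩ f ⁻¹' A ∈ U := hUle self_mem_nhdsWithin
  set R := ‖b₁‖ + ‖b₂‖ + ‖b₃‖ + ‖b₄‖
  have hcomp : IsCompact (A ∩ Metric.closedBall 0 R) := (isCompact_closedBall 0 R).inter_left hA
  obtain ⟨y, ⟨hyA, -⟩, hy⟩ := hcomp.ultrafilter_le_nhds
    ((Ultrafilter.of (nhdsWithin ζ (Metric.ball 0 1 ∩ f ⁻¹' A))).map f) (by
      rw [Filter.le_principal_iff, Ultrafilter.coe_map, Filter.mem_map]
      refine Filter.mem_of_superset hUmem fun z hz => ⟨hz.2, ?_⟩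
      simpa using norm_poissonExtension_stepFunction_le hp (by simpa using hz.1))
  have hy : Filter.Tendsto f U (nhds y) := hy
  have hζ1 : ‖ζ‖ ≤ 1 := by
    have := closure_mono (Set.inter_subset_left) hζ
    simpa using Metric.closure_ball_subset_closedBall this
  rcases hζ1.lt_or_eq with h | h
  · have hζb : ζ ∈ Metric.ball (0 : ℂ) 1 := by simpa using h
    have hlim : Filter.Tendsto f U (nhds (f ζ)) := (hc ζ hζb).mono_left hUball
    exact ⟨hζb, (tendsto_nhds_unique hy hlim ▸ hyA : f ζ ∈ A)⟩
  · exact absurd (mem_quadBoundary_of_tendsto hp h hUball hy) (Set.disjoint_left.1 hd hyA)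

end StepFunction

/-! ### Möbius automorphisms of the disk -/

theorem norm_one_sub_mul_conj_sq_sub (z a : ℂ) :
    ‖1 - z * conj a‖ ^ 2 - ‖z - a‖ ^ 2 = (1 - ‖z‖ ^ 2) * (1 - ‖a‖ ^ 2) := by
  simp only [Complex.sq_norm, Complex.normSq_apply]
  simp
  ring

theorem one_sub_mul_conj_ne_zero {z a : ℂ} (hz : ‖z‖ < 1) (ha : ‖a‖ < 1) : 1 - z * conj a ≠ 0 := by
  intro h
  have h1 : ‖z * conj a‖ = 1 := by rw [← sub_eq_zero.1 h, norm_one]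
  rw [norm_mul, Complex.norm_conj] at h1
  nlinarith [norm_nonneg z, norm_nonneg a]

theorem norm_diskMobius_lt {X a z : ℂ} (hX : ‖X‖ = 1) (ha : ‖a‖ < 1) (hz : ‖z‖ < 1) :
    ‖diskMobius X a z‖ < 1 := by
  have h := norm_one_sub_mul_conj_sq_sub z a
  have h1 := norm_pos_iff.2 (one_sub_mul_conj_ne_zero hz ha)
  rw [diskMobius, norm_mul, hX, one_mul, norm_div, div_lt_one h1]
  refine lt_of_pow_lt_pow_left₀ 2 h1.le ?_
  have h2 : 0 < 1 - ‖z‖ ^ 2 := by nlinarith [norm_nonneg z]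
  have h3 : 0 < 1 - ‖a‖ ^ 2 := by nlinarith [norm_nonneg a]
  nlinarith [mul_pos h2 h3]

theorem diskMobius_leftInverse {X a z : ℂ} (hX : ‖X‖ = 1) (ha : ‖a‖ < 1) (hz : ‖z‖ < 1) :
    diskMobius X⁻¹ (-(X * a)) (diskMobius X a z) = z := by
  have hX0 : X ≠ 0 := norm_ne_zero_iff.1 (by rw [hX]; exact one_ne_zero)
  have hXX : conj X = X⁻¹ := by
    rw [Complex.inv_def, Complex.normSq_eq_norm_sq, hX]; simp
  have h1 := one_sub_mul_conj_ne_zero hz ha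
  have h2 : 1 - a * conj a ≠ 0 := one_sub_mul_conj_ne_zero ha ha
  have h3 : (1 - z * conj a) + (z - a) * conj a = 1 - a * conj a := by ring
  simp only [diskMobius, map_neg, map_mul, hXX]
  have e : 1 - X * ((z - a) / (1 - z * conj a)) * -(X⁻¹ * conj a) =
      (1 - a * conj a) / (1 - z * conj a) := by
    rw [eq_div_iff h1, ← h3]; field_simp; ring
  rw [e]
  field_simp
  ring

theorem bijOn_diskMobius {X a : ℂ} (hX : ‖X‖ = 1) (ha : ‖a‖ < 1) :
    Set.BijOn (diskMobius X a) (Metric.ball 0 1) (Metric.ball 0 1) := by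
  have hX' : ‖X⁻¹‖ = 1 := by rw [norm_inv, hX, inv_one]
  have ha' : ‖-(X * a)‖ < 1 := by rwa [norm_neg, norm_mul, hX, one_mul]
  have hX0 : X ≠ 0 := norm_ne_zero_iff.1 (by rw [hX]; exact one_ne_zero)
  refine Set.InvOn.bijOn (f' := diskMobius X⁻¹ (-(X * a))) ⟨fun z hz => ?_, fun z hz => ?_⟩
    (fun z hz => ?_) (fun z hz => ?_) <;> rw [mem_ball_zero_iff] at hz
  · exact diskMobius_leftInverse hX ha hz
  · have := diskMobius_leftInverse hX' ha' hz
    rwa [inv_inv, mul_neg, neg_neg, inv_mul_cancel_left₀ hX0] at this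
  · exact mem_ball_zero_iff.2 (norm_diskMobius_lt hX ha hz)
  · exact mem_ball_zero_iff.2 (norm_diskMobius_lt hX' ha' hz)

/-! ### Decomposition f = h + conj g and its Jacobian -/

section HarmonicDecomposition

variable (b₁ b₂ b₃ b₄ : ℂ) (p : ℝ)

/-- The analytic part, normalised at the origin, of the Poisson extension of the step function. -/
noncomputable def stepCauchy (z : ℂ) : ℂ :=
  -Complex.I / (2 * Real.pi) *
    (b₄ * (circleLog p z - circleLog 0 z) + b₁ * (circleLog Real.pi z - circleLog p z) +
      b₂ * (circleLog (Real.pi + p) z - circleLog Real.pi z) +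
      b₃ * (circleLog 0 z - circleLog (Real.pi + p) z))

theorem stepCauchy_zero : stepCauchy b₁ b₂ b₃ b₄ p 0 = 0 := by
  simp [stepCauchy, circleLog_zero]

/-- Each logarithm contributes a simple pole at one of the jumps 1, w, -1, -w; the numerator appears
over the common denominator. -/
theorem hasDerivAt_stepCauchy {z : ℂ} (hz : ‖z‖ < 1) :
    HasDerivAt (stepCauchy b₁ b₂ b₃ b₄ p)
      (-Complex.I / (2 * Real.pi) * (jumpNumerator b₁ b₂ b₃ b₄ (Complex.exp (p * Complex.I)) z /
        ((1 - z ^ 2) * (Complex.exp (p * Complex.I) ^ 2 - z ^ 2)))) z := by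
  have d0 := hasDerivAt_circleLog hz 0
  have d1 := hasDerivAt_circleLog hz p
  have d2 := hasDerivAt_circleLog hz Real.pi
  have d3 := hasDerivAt_circleLog hz (Real.pi + p)
  have n0 := exp_sub_ne_zero hz 0
  have n1 := exp_sub_ne_zero hz p
  have n2 := exp_sub_ne_zero hz Real.pi
  have n3 := exp_sub_ne_zero hz (Real.pi + p)
  have e0 : Complex.exp ((0 : ℝ) * Complex.I) = 1 := by simp
  have e3 : Complex.exp ((Real.pi + p : ℝ) * Complex.I) = -Complex.exp (p * Complex.I) := by
    push_cast; rw [add_mul, Complex.exp_add, Complex.exp_pi_mul_I]; ring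
  rw [e0] at d0 n0
  rw [Complex.exp_pi_mul_I] at d2 n2
  rw [e3] at d3 n3
  refine ((((((d1.sub d0).const_mul b₄).add ((d2.sub d1).const_mul b₁)).add
    ((d3.sub d2).const_mul b₂)).add ((d0.sub d3).const_mul b₃)).const_mul
    (-Complex.I / (2 * Real.pi))).congr_deriv ?_
  congr 1
  set w := Complex.exp (p * Complex.I)
  have f1 : 1 - z ^ 2 = -((1 - z) * (-1 - z)) := by ring
  have f2 : w ^ 2 - z ^ 2 = -((w - z) * (-w - z)) := by ring
  rw [f1, f2, eq_div_iff (by simp [n0, n1, n2, n3]), jumpNumerator]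
  field_simp
  ring

theorem differentiableOn_stepCauchy :
    DifferentiableOn ℂ (stepCauchy b₁ b₂ b₃ b₄ p) (Metric.ball 0 1) := fun _ hz =>
  (hasDerivAt_stepCauchy b₁ b₂ b₃ b₄ p
    (mem_ball_zero_iff.1 hz)).differentiableAt.differentiableWithinAt

/-- Writing each imaginary part as (x - conj x)/(2i) separates the two parts. The antianalytic one
is the conjugate of the same Cauchy-type function built from the conjugated vertices; the constant
is f(0). -/
theorem poissonExtension_stepFunction_eq_add_conj {p : ℝ} (hp : p ∈ Set.Ioo 0 Real.pi) {z : ℂ}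
    (hz : ‖z‖ < 1) :
    poissonExtension (stepFunction b₁ b₂ b₃ b₄ p) z =
      ((p * b₄ + (Real.pi - p) * b₁ + p * b₂ + (Real.pi - p) * b₃) / (2 * Real.pi) +
        stepCauchy b₁ b₂ b₃ b₄ p z) +
        conj (stepCauchy (conj b₁) (conj b₂) (conj b₃) (conj b₄) p z) := by
  have him : ∀ x : ℂ, (x.im : ℂ) = (x - conj x) * (-Complex.I / 2) := by
    intro x
    rw [Complex.im_eq_sub_conj, div_eq_iff (by simp)]
    linear_combination (x - conj x) * Complex.I_sq
  have hpi : (Real.pi : ℂ) ≠ 0 := by exact_mod_cast Real.pi_ne_zero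
  rw [poissonExtension_stepFunction _ _ _ _ hp hz]
  simp only [arcMeasure_eq hz, circleLog_two_pi, stepCauchy]
  push_cast
  rw [him, him, him, him]
  simp only [map_mul, map_add, map_sub, map_div₀, map_neg, Complex.conj_I, Complex.conj_ofReal,
    Complex.conj_conj, map_ofNat]
  field_simp
  ring

end HarmonicDecomposition

theorem det_add_conj (a b : ℂ) :
    (a • (1 : ℂ →L[ℝ] ℂ) + (Complex.conjCLE : ℂ →L[ℝ] ℂ).comp (b • (1 : ℂ →L[ℝ] ℂ))).det =
      ‖a‖ ^ 2 - ‖b‖ ^ 2 := by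
  rw [ContinuousLinearMap.det, ← LinearMap.det_toMatrix Complex.basisOneI, Matrix.det_fin_two]
  simp [LinearMap.toMatrix_apply, Complex.sq_norm, Complex.normSq_apply]
  ring

theorem hasFDerivAt_add_conj {h g : ℂ → ℂ} {a b z : ℂ} (hh : HasDerivAt h a z)
    (hg : HasDerivAt g b z) :
    HasFDerivAt (fun z => h z + conj (g z))
      (a • (1 : ℂ →L[ℝ] ℂ) + (Complex.conjCLE : ℂ →L[ℝ] ℂ).comp (b • (1 : ℂ →L[ℝ] ℂ))) z := by
  have h1 := hh.complexToReal_fderiv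
  have h2 := hg.complexToReal_fderiv
  exact h1.add ((Complex.conjCLE : ℂ →L[ℝ] ℂ).hasFDerivAt.comp z h2)

/-- A sum of an analytic and a conjugate-analytic function whose dilatation has modulus less than
`1` is a sense-preserving harmonic map. -/
theorem harmonic_of_dilatation {f h g φ : ℂ → ℂ} {U : Set ℂ} (hU : IsOpen U)
    (hh : DifferentiableOn ℂ h U) (hg : DifferentiableOn ℂ g U)
    (hf : ∀ z ∈ U, f z = h z + conj (g z)) (hne : ∀ z ∈ U, deriv h z ≠ 0)
    (hφ : ∀ z ∈ U, deriv g z / deriv h z = φ z) (hφ1 : ∀ z ∈ U, ‖φ z‖ < 1) :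
    InnerProductSpace.HarmonicOnNhd f U ∧ IsSensePreservingOn f U ∧ ContDiffOn ℝ ∞ f U := by
  have heq : ∀ z ∈ U, f =ᶠ[nhds z] fun z => h z + conj (g z) := fun z hz =>
    Filter.eventually_of_mem (hU.mem_nhds hz) hf
  refine ⟨fun z hz => ?_, fun z hz => ?_, fun z hz => ?_⟩
  · rw [InnerProductSpace.harmonicAt_congr_nhds (heq z hz)]
    exact (hh.analyticAt (hU.mem_nhds hz)).harmonicAt.add
      (hg.analyticAt (hU.mem_nhds hz)).harmonicAt_conj
  · have hd := (hasFDerivAt_add_conj (hh.hasDerivAt (hU.mem_nhds hz))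
      (hg.hasDerivAt (hU.mem_nhds hz))).congr_of_eventuallyEq (heq z hz)
    refine ⟨hd.differentiableAt, ?_⟩
    rw [hd.fderiv, det_add_conj]
    have h1 := norm_pos_iff.2 (hne z hz)
    have h2 := hφ1 z hz
    rw [← hφ z hz, norm_div, div_lt_one h1] at h2
    nlinarith [norm_nonneg (deriv g z)]
  · have h1 : ContDiffAt ℝ ∞ h z := ((hh.analyticAt (hU.mem_nhds hz)).contDiffAt).restrict_scalars ℝ
    have h2 : ContDiffAt ℝ ∞ g z := ((hg.analyticAt (hU.mem_nhds hz)).contDiffAt).restrict_scalars ℝ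
    exact ((h1.add (Complex.conjCLE.contDiff.contDiffAt.comp z h2)).congr_of_eventuallyEq
      (heq z hz)).contDiffWithinAt

/-! ### Hyperbolic coordinates from the Pitot condition -/

theorem exists_eq_hyperbolaPoint {b₁ b₃ b : ℂ} {m : ℝ} (hne : b₁ ≠ b₃) (hm : 0 < Real.cos m)
    (h : dist b b₁ - dist b b₃ = dist b₃ b₁ * Real.sin m) :
    ∃ τ, b = hyperbolaPoint b₁ b₃ m τ := by
  have hd : (b₃ - b₁) / 2 ≠ 0 := by
    rw [div_ne_zero_iff]; exact ⟨sub_ne_zero.2 hne.symm, two_ne_zero⟩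
  set d := (b₃ - b₁) / 2 with hd'
  set x := (b - (b₁ + b₃) / 2) / d with hx
  have hb : b = (b₁ + b₃) / 2 + d * x := by rw [hx]; field_simp; ring
  have hd0 := norm_pos_iff.2 hd
  have e1 : dist b b₁ = ‖d‖ * ‖x + 1‖ := by
    rw [dist_eq_norm, ← norm_mul, hb, hd']; congr 1; ring
  have e3 : dist b b₃ = ‖d‖ * ‖x - 1‖ := by
    rw [dist_eq_norm, ← norm_mul, hb, hd']; congr 1; ring
  have e2 : dist b₃ b₁ = ‖d‖ * 2 := by
    rw [dist_eq_norm, hd', norm_div, Complex.norm_ofNat]; ring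
  rw [e1, e2, e3, ← mul_sub, mul_assoc] at h
  have h := mul_left_cancel₀ hd0.ne' h
  have q1 : ‖x + 1‖ ^ 2 = (x.re + 1) ^ 2 + x.im ^ 2 := by
    rw [Complex.sq_norm, Complex.normSq_apply]; simp; ring
  have q3 : ‖x - 1‖ ^ 2 = (x.re - 1) ^ 2 + x.im ^ 2 := by
    rw [Complex.sq_norm, Complex.normSq_apply]; simp; ring
  -- Half the sum of the focal distances is the future cosh τ: the focal distances are C ± sin m,
  -- and comparing their squares gives Re x = C sin m and (Im x)² = (C² - 1) cos² m.
  set C := (‖x + 1‖ + ‖x - 1‖) / 2 with hC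
  have hC0 : 0 ≤ C := by positivity
  have p1 : ‖x + 1‖ = C + Real.sin m := by rw [hC]; linarith
  have p3 : ‖x - 1‖ = C - Real.sin m := by rw [hC]; linarith
  rw [p1] at q1
  rw [p3] at q3
  have hre : x.re = Real.sin m * C := by nlinarith
  have hcs := Real.sin_sq_add_cos_sq m
  have him : (C ^ 2 - 1) * Real.cos m ^ 2 = x.im ^ 2 := by
    rw [hre] at q1
    linear_combination q1 + (C ^ 2 - 1) * hcs
  set τ := Real.arsinh (x.im / Real.cos m) with hτ
  have hsinh : Real.cos m * Real.sinh τ = x.im := by rw [hτ, Real.sinh_arsinh]; field_simp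
  have hcosh : Real.cosh τ = C := by
    have h1 : Real.cosh τ ^ 2 = C ^ 2 := by
      have h2 : Real.cos m ^ 2 * Real.cosh τ ^ 2 = Real.cos m ^ 2 * C ^ 2 := by
        rw [Real.cosh_sq]
        rw [← hsinh] at him
        linear_combination -him
      exact mul_left_cancel₀ (by positivity) h2
    exact (pow_left_inj₀ (Real.cosh_pos τ).le hC0 two_ne_zero).1 h1
  refine ⟨τ, ?_⟩
  rw [hyperbolaPoint, hsinh, hcosh, ← hre, ← hd', Complex.re_add_im]
  exact hb

/-- Disjointness of opposite sides keeps b₃ off [b₁, b₂] and b₁ off [b₂, b₃], so both triangle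
inequalities are strict. This makes |sin m| < 1. -/
theorem abs_dist_sub_dist_lt {b₁ b₂ b₃ b₄ : ℂ} (h : IsQuadrilateral b₁ b₂ b₃ b₄) :
    |dist b₂ b₁ - dist b₂ b₃| < dist b₃ b₁ := by
  have d1 := Set.disjoint_left.1 h.disj₁₃
  have d2 := Set.disjoint_left.1 h.disj₂₄
  have n1 : b₃ ∉ segment ℝ b₁ b₂ := fun h3 => d1 h3 (left_mem_segment ℝ _ _)
  have n2 : b₁ ∉ segment ℝ b₂ b₃ := fun h3 => d2 h3 (right_mem_segment ℝ _ _)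
  rw [mem_segment_iff_wbtw, ← dist_add_dist_eq_iff] at n1 n2
  have t1 := dist_triangle b₁ b₃ b₂
  have t2 := dist_triangle b₂ b₁ b₃
  have t1' := lt_of_le_of_ne t1 (Ne.symm n1)
  have t2' := lt_of_le_of_ne t2 (Ne.symm n2)
  rw [dist_comm b₁ b₂, dist_comm b₁ b₃, dist_comm b₃ b₂] at t1'
  rw [dist_comm b₁ b₃] at t2'
  rw [abs_lt]
  constructor <;> linarith

theorem quadSignedArea_eq (b₁ b₂ b₃ b₄ : ℂ) :
    quadSignedArea b₁ b₂ b₃ b₄ = (conj (b₃ - b₁) * (b₄ - b₂)).im / 2 := by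
  simp [quadSignedArea]
  ring

theorem quadSignedArea_hyperbolaPoint (b₁ b₃ : ℂ) (m s t : ℝ) :
    quadSignedArea b₁ (hyperbolaPoint b₁ b₃ m t) b₃ (hyperbolaPoint b₁ b₃ m s) =
      Complex.normSq (b₃ - b₁) / 4 * (Real.cos m * (Real.sinh s - Real.sinh t)) := by
  have : conj (b₃ - b₁) * (hyperbolaPoint b₁ b₃ m s - hyperbolaPoint b₁ b₃ m t) =
      (Complex.normSq (b₃ - b₁) : ℂ) * (((Real.sin m * (Real.cosh s - Real.cosh t) / 2 : ℝ) : ℂ) +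
        (Real.cos m * (Real.sinh s - Real.sinh t) / 2 : ℝ) * Complex.I) := by
    rw [Complex.normSq_eq_conj_mul_self, hyperbolaPoint, hyperbolaPoint]
    push_cast
    ring
  rw [quadSignedArea_eq, this, Complex.im_ofReal_mul, Complex.add_im, Complex.ofReal_im,
    Complex.im_ofReal_mul, Complex.I_im]
  ring

/-! ### The dilatation is the square of a Möbius map -/

theorem jumpNumerator_hyperbolaPoint (b₁ b₃ w z : ℂ) (m s t : ℝ)
    (hw : w = ((Real.exp (s / 2) + Complex.I * Real.exp (t / 2)) /
      (Real.exp (s / 2) - Complex.I * Real.exp (t / 2))) ^ 2)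
    {S T μ : ℂ} (hS : S = Real.exp (s / 2)) (hT : T = Real.exp (t / 2))
    (hμ : μ = Complex.exp (m * Complex.I)) (hST : S - Complex.I * T ≠ 0) :
    jumpNumerator b₁ (hyperbolaPoint b₁ b₃ m t) b₃ (hyperbolaPoint b₁ b₃ m s) w z *
        (μ * (S * T) * (S - Complex.I * T) ^ 4) =
      -((b₃ - b₁) * (S ^ 2 - T ^ 2)) *
        ((S + Complex.I * T) * (μ + S * T) - z * (S - Complex.I * T) * (μ - S * T)) ^ 2 ∧
    jumpNumerator (conj b₁) (conj (hyperbolaPoint b₁ b₃ m t)) (conj b₃)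
        (conj (hyperbolaPoint b₁ b₃ m s)) w z * (μ * (S * T) * (S - Complex.I * T) ^ 4) =
      (conj (b₃ - b₁) * (S ^ 2 - T ^ 2)) *
        (z * (S - Complex.I * T) * (1 + μ * (S * T)) - (S + Complex.I * T) * (1 - μ * (S * T))) ^ 2 := by
  have hS0 : S ≠ 0 := by rw [hS]; exact_mod_cast (Real.exp_pos _).ne'
  have hT0 : T ≠ 0 := by rw [hT]; exact_mod_cast (Real.exp_pos _).ne'
  have hμ0 : μ ≠ 0 := by rw [hμ]; exact Complex.exp_ne_zero _
  have hcμ : conj μ = μ⁻¹ := by rw [hμ, conj_exp_ofReal_mul_I]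
  have hcS : conj S = S := by rw [hS, Complex.conj_ofReal]
  have hcT : conj T = T := by rw [hT, Complex.conj_ofReal]
  rw [hyperbolaPoint_eq, hyperbolaPoint_eq, hw, ← hS, ← hT, ← hμ]
  constructor
  · have key := jumpNumerator_hyperbola Complex.I_sq hS0 hT0 hμ0 hST z
    have haff := jumpNumerator_affine ((b₁ + b₃) / 2) ((b₃ - b₁) / 2) (-1)
      (Complex.I / 2 * (T ^ 2 / μ - μ / T ^ 2)) 1 (Complex.I / 2 * (S ^ 2 / μ - μ / S ^ 2))
      (((S + Complex.I * T) / (S - Complex.I * T)) ^ 2) z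
    rw [show (b₁ + b₃) / 2 + (b₃ - b₁) / 2 * (-1) = b₁ by ring,
      show (b₁ + b₃) / 2 + (b₃ - b₁) / 2 * 1 = b₃ by ring] at haff
    rw [haff]
    linear_combination (b₃ - b₁) / 2 * key
  -- Conjugation turns sin(m + iτ) into sin(m - iτ) = sin((π - m) + iτ), so μ becomes exp(i(π - m))
  -- = -1/μ while w and the factor i stay as they are.
  · have hμ' : -μ⁻¹ ≠ 0 := neg_ne_zero.2 (inv_ne_zero hμ0)
    have key := jumpNumerator_hyperbola Complex.I_sq hS0 hT0 hμ' hST z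
    have haff := jumpNumerator_affine ((conj b₁ + conj b₃) / 2) ((conj b₃ - conj b₁) / 2) (-1)
      (Complex.I / 2 * (T ^ 2 / -μ⁻¹ - -μ⁻¹ / T ^ 2)) 1
      (Complex.I / 2 * (S ^ 2 / -μ⁻¹ - -μ⁻¹ / S ^ 2))
      (((S + Complex.I * T) / (S - Complex.I * T)) ^ 2) z
    rw [show (conj b₁ + conj b₃) / 2 + (conj b₃ - conj b₁) / 2 * (-1) = conj b₁ by ring,
      show (conj b₁ + conj b₃) / 2 + (conj b₃ - conj b₁) / 2 * 1 = conj b₃ by ring] at haff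
    have hconj : ∀ U : ℂ, conj U = U →
        conj ((b₁ + b₃) / 2 + (b₃ - b₁) / 2 * (Complex.I / 2 * (U ^ 2 / μ - μ / U ^ 2))) =
        (conj b₁ + conj b₃) / 2 + (conj b₃ - conj b₁) / 2 *
          (Complex.I / 2 * (U ^ 2 / -μ⁻¹ - -μ⁻¹ / U ^ 2)) := by
      intro U hU
      simp only [map_add, map_mul, map_sub, map_div₀, map_pow, Complex.conj_I, hU, hcμ, map_ofNat,
        div_neg]
      ring
    rw [hconj T hcT, hconj S hcS, haff, map_sub]
    have e : μ * (S * T) * (S - Complex.I * T) ^ 4 =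
        -μ ^ 2 * (-μ⁻¹ * (S * T) * (S - Complex.I * T) ^ 4) := by field_simp
    rw [e]
    have e2 : (S + Complex.I * T) * (-μ⁻¹ + S * T) - z * (S - Complex.I * T) * (-μ⁻¹ - S * T) =
        μ⁻¹ * (z * (S - Complex.I * T) * (1 + μ * (S * T)) -
          (S + Complex.I * T) * (1 - μ * (S * T))) := by field_simp; ring
    rw [e2] at key
    have e3 : μ ^ 2 * μ⁻¹ ^ 2 = 1 := by field_simp
    linear_combination -(conj b₃ - conj b₁) / 2 * μ ^ 2 * key +
      (conj b₃ - conj b₁) * (S ^ 2 - T ^ 2) * (z * (S - Complex.I * T) * (1 + μ * (S * T)) -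
        (S + Complex.I * T) * (1 - μ * (S * T))) ^ 2 * e3

/-- The dilatation of the Poisson extension is the square of the Möbius map. -/
theorem jumpNumerator_dilatation {b₁ b₃ w X z₀ z : ℂ} {m s t : ℝ} (hb : b₁ ≠ b₃) (hst : t < s)
    (hm : 0 < Real.cos m) (hz : ‖z‖ < 1)
    (hw : w = ((Real.exp (s / 2) + Complex.I * Real.exp (t / 2)) /
      (Real.exp (s / 2) - Complex.I * Real.exp (t / 2))) ^ 2)
    (hX : X = conj (b₃ - b₁) / (‖b₃ - b₁‖ : ℂ) *
          (((Complex.I * Real.exp (s / 2) + Real.exp (t / 2)) *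
              (1 + Complex.exp (m * Complex.I) * Real.exp ((s + t) / 2))) /
            ((Real.exp (s / 2) + Complex.I * Real.exp (t / 2)) *
              (Complex.exp (m * Complex.I) + Real.exp ((s + t) / 2)))))
    (hz₀ : z₀ = ((Real.exp (s / 2) + Complex.I * Real.exp (t / 2)) *
              (1 - Complex.exp (m * Complex.I) * Real.exp ((s + t) / 2))) /
            ((Real.exp (s / 2) - Complex.I * Real.exp (t / 2)) *
              (1 + Complex.exp (m * Complex.I) * Real.exp ((s + t) / 2)))) :
    jumpNumerator b₁ (hyperbolaPoint b₁ b₃ m t) b₃ (hyperbolaPoint b₁ b₃ m s) w z ≠ 0 ∧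
    jumpNumerator (conj b₁) (conj (hyperbolaPoint b₁ b₃ m t)) (conj b₃)
        (conj (hyperbolaPoint b₁ b₃ m s)) w z =
      diskMobius X z₀ z ^ 2 *
        jumpNumerator b₁ (hyperbolaPoint b₁ b₃ m t) b₃ (hyperbolaPoint b₁ b₃ m s) w z := by
  have hz₀1 : ‖z₀‖ < 1 := by rw [hz₀]; exact norm_hyperbolaCenter_lt hm
  have hden := one_sub_mul_conj_ne_zero hz hz₀1
  have hr := (norm_nonneg _).trans_lt (norm_one_sub_lt hm (Real.exp_pos ((s + t) / 2)))
  have hν : (1 : ℂ) + Complex.exp (m * Complex.I) * Real.exp ((s + t) / 2) ≠ 0 :=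
    norm_pos_iff.1 hr
  have hν' : Complex.exp (m * Complex.I) + Real.exp ((s + t) / 2) ≠ 0 := by
    rw [← norm_exp_add] at hr; exact norm_pos_iff.1 hr
  rw [exp_half_mul_exp_half] at hX hz₀ hν hν'
  have hα := ofReal_add_I_mul_ne_zero (Real.exp_pos (s / 2)) (Real.exp (t / 2))
  have hβ : (Real.exp (s / 2) : ℂ) - Complex.I * Real.exp (t / 2) ≠ 0 := by
    rw [← norm_pos_iff, norm_sub_I_mul]; exact norm_pos_iff.2 hα
  have hq : (Real.exp (s / 2) : ℂ) ^ 2 - (Real.exp (t / 2) : ℂ) ^ 2 ≠ 0 := by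
    have : Real.exp (t / 2) < Real.exp (s / 2) := Real.exp_lt_exp.2 (by linarith)
    have h0 := Real.exp_pos (t / 2)
    have : Real.exp (s / 2) ^ 2 - Real.exp (t / 2) ^ 2 ≠ 0 := by nlinarith
    exact_mod_cast this
  have hμc := conj_exp_ofReal_mul_I m
  obtain ⟨hN, hM⟩ := jumpNumerator_hyperbolaPoint b₁ b₃ w z m s t hw rfl rfl rfl hβ
  have hμ0 := Complex.exp_ne_zero (m * Complex.I)
  have hS0 : (Real.exp (s / 2) : ℂ) ≠ 0 := by exact_mod_cast (Real.exp_pos _).ne'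
  have hT0 : (Real.exp (t / 2) : ℂ) ≠ 0 := by exact_mod_cast (Real.exp_pos _).ne'
  have hcS : conj (Real.exp (s / 2) : ℂ) = Real.exp (s / 2) := Complex.conj_ofReal _
  have hcT : conj (Real.exp (t / 2) : ℂ) = Real.exp (t / 2) := Complex.conj_ofReal _
  generalize (Real.exp (s / 2) : ℂ) = S at *
  generalize (Real.exp (t / 2) : ℂ) = T at *
  generalize Complex.exp (m * Complex.I) = μ at *
  have hν₂ : 1 + S * T * μ ≠ 0 := by rwa [mul_comm]
  generalize jumpNumerator (conj b₁) (conj (hyperbolaPoint b₁ b₃ m t)) (conj b₃)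
        (conj (hyperbolaPoint b₁ b₃ m s)) w z = M at *
  generalize jumpNumerator b₁ (hyperbolaPoint b₁ b₃ m t) b₃ (hyperbolaPoint b₁ b₃ m s) w z = N at *
  have hd : b₃ - b₁ ≠ 0 := sub_ne_zero.2 hb.symm
  have hn : (‖b₃ - b₁‖ : ℂ) ≠ 0 := by exact_mod_cast norm_ne_zero_iff.2 hd
  have hn2 : (‖b₃ - b₁‖ : ℂ) ^ 2 = conj (b₃ - b₁) * (b₃ - b₁) := by
    rw [← Complex.normSq_eq_conj_mul_self, Complex.normSq_eq_norm_sq]; push_cast; rfl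
  set A := (S + Complex.I * T) * (μ + S * T) - z * (S - Complex.I * T) * (μ - S * T) with hA
  set B := z * (S - Complex.I * T) * (1 + μ * (S * T)) - (S + Complex.I * T) * (1 - μ * (S * T)) with hB
  have hcz : conj z₀ = ((S - Complex.I * T) * (μ - S * T)) / ((S + Complex.I * T) * (μ + S * T)) := by
    rw [hz₀]
    simp only [map_add, map_mul, map_sub, map_div₀, Complex.conj_I, hcS, hcT, hμc, map_one,
      neg_mul, sub_neg_eq_add, ← sub_eq_add_neg]
    have e1 : 1 + μ⁻¹ * (S * T) = μ⁻¹ * (μ + S * T) := by field_simp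
    have e2 : 1 - μ⁻¹ * (S * T) = μ⁻¹ * (μ - S * T) := by field_simp
    rw [e1, e2]
    field_simp
  have hA1 : 1 - z * conj z₀ = A / ((S + Complex.I * T) * (μ + S * T)) := by
    rw [hcz, hA]; field_simp
  -- A is a nonzero multiple of 1 - z conj z₀, hence has no zero in the disk; B is likewise a
  -- multiple of z - z₀.
  have hA0 : A ≠ 0 := by
    intro h
    rw [hA1, h, zero_div] at hden
    exact hden rfl
  have hφ : diskMobius X z₀ z = conj (b₃ - b₁) / (‖b₃ - b₁‖ : ℂ) * Complex.I * (B / A) := by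
    have e : Complex.I * S + T = Complex.I * (S - Complex.I * T) := by
      linear_combination T * Complex.I_sq
    have e' : z - z₀ = B / ((S - Complex.I * T) * (1 + μ * (S * T))) := by
      rw [hz₀, hB]; field_simp
    rw [diskMobius, hA1, e', hX, e]
    field_simp
  -- The phase of X cancels the ratio of the factors conj(b₃ - b₁) and b₃ - b₁ in the two
  -- numerators, and i² supplies their opposite sign.
  have hφ2 : diskMobius X z₀ z ^ 2 * (b₃ - b₁) = -conj (b₃ - b₁) * (B / A) ^ 2 := by
    rw [hφ, mul_pow, mul_pow, div_pow, hn2, Complex.I_sq]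
    have hd' : conj (b₃ - b₁) ≠ 0 := (map_ne_zero _).2 hd
    field_simp
  have hc : μ * (S * T) * (S - Complex.I * T) ^ 4 ≠ 0 := by simp [hμ0, hS0, hT0, hβ]
  constructor
  · intro h
    rw [h, zero_mul] at hN
    exact mul_ne_zero (neg_ne_zero.2 (mul_ne_zero hd hq)) (pow_ne_zero 2 hA0) hN.symm
  · apply mul_right_cancel₀ hc
    rw [mul_assoc _ N, hN, hM]
    have : diskMobius X z₀ z ^ 2 * (-((b₃ - b₁) * (S ^ 2 - T ^ 2)) * A ^ 2) =
        -(diskMobius X z₀ z ^ 2 * (b₃ - b₁)) * (S ^ 2 - T ^ 2) * A ^ 2 := by ring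
    rw [this, hφ2]
    field_simp

/-! ### The main theorem -/

theorem theorem1 (b₁ b₂ b₃ b₄ : ℂ) (hQ : IsPitotQuadrilateral b₁ b₂ b₃ b₄) :
    -- the hyperbolic coordinates `t` of `b₂` and `s` of `b₄`, and the constants `p`, `X`, `z₀`
    ∃ m s t p : ℝ, ∃ X z₀ : ℂ,
      m ∈ Set.Ioo (-(Real.pi / 2)) (Real.pi / 2) ∧ t < s ∧
      dist b₂ b₁ - dist b₂ b₃ = dist b₃ b₁ * Real.sin m ∧
      dist b₄ b₁ - dist b₄ b₃ = dist b₃ b₁ * Real.sin m ∧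
      b₂ = hyperbolaPoint b₁ b₃ m t ∧
      b₄ = hyperbolaPoint b₁ b₃ m s ∧
      -- the explicit values
      p = Real.arccos (1 - 4 / (1 + Real.cosh (s - t))) ∧
      X = conj (b₃ - b₁) / (‖b₃ - b₁‖ : ℂ) *
          (((Complex.I * Real.exp (s / 2) + Real.exp (t / 2)) *
              (1 + Complex.exp (m * Complex.I) * Real.exp ((s + t) / 2))) /
            ((Real.exp (s / 2) + Complex.I * Real.exp (t / 2)) *
              (Complex.exp (m * Complex.I) + Real.exp ((s + t) / 2)))) ∧
      z₀ = ((Real.exp (s / 2) + Complex.I * Real.exp (t / 2)) *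
              (1 - Complex.exp (m * Complex.I) * Real.exp ((s + t) / 2))) /
            ((Real.exp (s / 2) - Complex.I * Real.exp (t / 2)) *
              (1 + Complex.exp (m * Complex.I) * Real.exp ((s + t) / 2))) ∧
      p ∈ Set.Ioo 0 Real.pi ∧ ‖X‖ = 1 ∧ ‖z₀‖ < 1 ∧
      Set.BijOn (diskMobius X z₀) (Metric.ball 0 1) (Metric.ball 0 1) ∧
      -- the Poisson extension is a sense-preserving harmonic map with dilatation `φ ^ 2`
      InnerProductSpace.HarmonicOnNhd (poissonExtension (stepFunction b₁ b₂ b₃ b₄ p))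
        (Metric.ball 0 1) ∧
      IsSensePreservingOn (poissonExtension (stepFunction b₁ b₂ b₃ b₄ p)) (Metric.ball 0 1) ∧
      (∃ h g : ℂ → ℂ, DifferentiableOn ℂ h (Metric.ball 0 1) ∧
        DifferentiableOn ℂ g (Metric.ball 0 1) ∧ g 0 = 0 ∧
        ∀ z ∈ Metric.ball (0 : ℂ) 1,
          poissonExtension (stepFunction b₁ b₂ b₃ b₄ p) z = h z + conj (g z) ∧
          deriv h z ≠ 0 ∧
          deriv g z / deriv h z = diskMobius X z₀ z ^ 2) ∧
      -- and it is a diffeomorphism of the unit disk onto the quadrilateral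
      IsDiffeoOnto (poissonExtension (stepFunction b₁ b₂ b₃ b₄ p)) (Metric.ball 0 1)
        (quadInterior b₁ b₂ b₃ b₄) := by
  have hq := hQ.toIsQuadrilateral
  have hne : b₁ ≠ b₃ := by
    rintro rfl
    exact Set.disjoint_left.1 hq.disj₁₃ (left_mem_segment ℝ _ _) (left_mem_segment ℝ _ _)
  have hdist : 0 < dist b₃ b₁ := dist_pos.2 hne.symm
  obtain ⟨hlo, hhi⟩ := abs_lt.1 (abs_dist_sub_dist_lt hq)
  set k := (dist b₂ b₁ - dist b₂ b₃) / dist b₃ b₁ with hk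
  have hk1 : -1 < k := by rw [hk, lt_div_iff₀ hdist]; linarith
  have hk2 : k < 1 := by rw [hk, div_lt_one hdist]; exact hhi
  set m := Real.arcsin k with hm
  have hmem : m ∈ Set.Ioo (-(Real.pi / 2)) (Real.pi / 2) :=
    ⟨Real.neg_pi_div_two_lt_arcsin.2 hk1, Real.arcsin_lt_pi_div_two.2 hk2⟩
  have hcos : 0 < Real.cos m := Real.cos_pos_of_mem_Ioo hmem
  have hsin : dist b₃ b₁ * Real.sin m = dist b₂ b₁ - dist b₂ b₃ := by
    rw [hm, Real.sin_arcsin hk1.le hk2.le, hk]; field_simp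
  have hfoc₂ : dist b₂ b₁ - dist b₂ b₃ = dist b₃ b₁ * Real.sin m := hsin.symm
  -- The Pitot equation, rearranged, says that b₂ and b₄ have the same difference of focal
  -- distances.
  have hfoc₄ : dist b₄ b₁ - dist b₄ b₃ = dist b₃ b₁ * Real.sin m := by
    have := hQ.pitot
    rw [hsin, dist_comm b₂ b₁, dist_comm b₄ b₃]; linarith
  obtain ⟨t, ht⟩ := exists_eq_hyperbolaPoint hne hcos hfoc₂
  obtain ⟨s, hs⟩ := exists_eq_hyperbolaPoint hne hcos hfoc₄
  -- The signed area is a positive multiple of sinh s - sinh t, so the counterclockwise orientation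
  -- orders the parameters.
  have hts : t < s := by
    have harea := hq.counterclockwise
    rw [ht, hs, quadSignedArea_hyperbolaPoint] at harea
    have h1 : 0 ≤ Complex.normSq (b₃ - b₁) / 4 := by
      have := Complex.normSq_nonneg (b₃ - b₁); positivity
    have h2 := pos_of_mul_pos_right (pos_of_mul_pos_right harea h1) hcos.le
    exact Real.sinh_lt_sinh.1 (sub_pos.1 h2)
  have hp := arccos_mem_Ioo (arccos_argument_mem hts)
  have hexp := exp_arccos_eq hts
  obtain ⟨p, hpe⟩ : ∃ p, p = Real.arccos (1 - 4 / (1 + Real.cosh (s - t))) := ⟨_, rfl⟩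
  rw [← hpe] at hp hexp
  obtain ⟨X, hX⟩ : ∃ X, X = conj (b₃ - b₁) / (‖b₃ - b₁‖ : ℂ) *
      (((Complex.I * Real.exp (s / 2) + Real.exp (t / 2)) *
          (1 + Complex.exp (m * Complex.I) * Real.exp ((s + t) / 2))) /
        ((Real.exp (s / 2) + Complex.I * Real.exp (t / 2)) *
          (Complex.exp (m * Complex.I) + Real.exp ((s + t) / 2)))) := ⟨_, rfl⟩
  obtain ⟨z₀, hz₀⟩ : ∃ z₀, z₀ = ((Real.exp (s / 2) + Complex.I * Real.exp (t / 2)) *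
          (1 - Complex.exp (m * Complex.I) * Real.exp ((s + t) / 2))) /
        ((Real.exp (s / 2) - Complex.I * Real.exp (t / 2)) *
          (1 + Complex.exp (m * Complex.I) * Real.exp ((s + t) / 2))) := ⟨_, rfl⟩
  have hX1 : ‖X‖ = 1 := by rw [hX]; exact norm_hyperbolaRotation hcos hne
  have hz₀1 : ‖z₀‖ < 1 := by rw [hz₀]; exact norm_hyperbolaCenter_lt hcos
  set f := poissonExtension (stepFunction b₁ b₂ b₃ b₄ p) with hf
  set h : ℂ → ℂ := fun z =>
    (p * b₄ + (Real.pi - p) * b₁ + p * b₂ + (Real.pi - p) * b₃) / (2 * Real.pi) +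
      stepCauchy b₁ b₂ b₃ b₄ p z with hh
  set g : ℂ → ℂ := stepCauchy (conj b₁) (conj b₂) (conj b₃) (conj b₄) p with hg
  have hhd : DifferentiableOn ℂ h (Metric.ball 0 1) :=
    (differentiableOn_stepCauchy b₁ b₂ b₃ b₄ p).const_add _
  have hgd : DifferentiableOn ℂ g (Metric.ball 0 1) := differentiableOn_stepCauchy _ _ _ _ p
  have hfhg : ∀ z ∈ Metric.ball (0 : ℂ) 1, f z = h z + conj (g z) := fun z hz =>
    poissonExtension_stepFunction_eq_add_conj b₁ b₂ b₃ b₄ hp (mem_ball_zero_iff.1 hz)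
  have hderiv : ∀ z ∈ Metric.ball (0 : ℂ) 1,
      deriv h z ≠ 0 ∧ deriv g z / deriv h z = diskMobius X z₀ z ^ 2 := by
    intro z hz
    rw [mem_ball_zero_iff] at hz
    have hdil := jumpNumerator_dilatation hne hts hcos hz hexp hX hz₀
    rw [← ht, ← hs] at hdil
    have e1 : deriv h z = _ := ((hasDerivAt_stepCauchy b₁ b₂ b₃ b₄ p hz).const_add _).deriv
    have e2 : deriv g z = _ := (hasDerivAt_stepCauchy _ _ _ _ p hz).deriv
    have hu : ‖Complex.exp (p * Complex.I)‖ = 1 := Complex.norm_exp_ofReal_mul_I p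
    have n1 : (1 : ℂ) - z ^ 2 ≠ 0 := by
      intro h0
      have := congrArg norm (sub_eq_zero.1 h0)
      rw [norm_one, norm_pow] at this
      nlinarith [norm_nonneg z]
    have n2 : Complex.exp (p * Complex.I) ^ 2 - z ^ 2 ≠ 0 := by
      intro h0
      have := congrArg norm (sub_eq_zero.1 h0)
      rw [norm_pow, norm_pow, hu] at this
      nlinarith [norm_nonneg z]
    have n3 : -Complex.I / (2 * Real.pi) ≠ 0 := by
      simp [Real.pi_ne_zero]
    have hne0 : deriv h z ≠ 0 := by
      rw [e1]
      exact mul_ne_zero n3 (div_ne_zero hdil.1 (mul_ne_zero n1 n2))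
    refine ⟨hne0, ?_⟩
    rw [div_eq_iff hne0, e1, e2, hdil.2]
    ring
  obtain ⟨hharm, hsense, hsmooth⟩ := harmonic_of_dilatation (φ := fun z => diskMobius X z₀ z ^ 2)
    Metric.isOpen_ball hhd hgd hfhg (fun z hz => (hderiv z hz).1) (fun z hz => (hderiv z hz).2)
    (fun z hz => by
      rw [norm_pow]
      exact pow_lt_one₀ (norm_nonneg _) (norm_diskMobius_lt hX1 hz₀1 (mem_ball_zero_iff.1 hz))
        two_ne_zero)
  obtain ⟨c, G, hG⟩ := hq.exists_centeredGauge
  have hint : quadInterior b₁ b₂ b₃ b₄ = {z | G z < 1} := hG.component_eq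
  have hbij : Set.BijOn f (Metric.ball 0 1) {z | G z < 1} :=
    hG.bijOn_ball hsmooth.continuousOn (hsense.isLocalHomeomorphOn Metric.isOpen_ball hsmooth)
      fun A hA hd => isCompact_ball_inter_preimage hp hsmooth.continuousOn hA hd
  have hdiffeo : IsDiffeoOnto f (Metric.ball 0 1) (quadInterior b₁ b₂ b₃ b₄) := by
    rw [hint]
    exact hsense.isDiffeoOnto Metric.isOpen_ball (isOpen_lt hG.continuous continuous_const)
      hsmooth hbij
  exact ⟨m, s, t, p, X, z₀, hmem, hts, hfoc₂, hfoc₄, ht, hs, hpe, hX, hz₀, hp, hX1, hz₀1,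
    bijOn_diskMobius hX1 hz₀1, hharm, hsense,
    ⟨h, g, hhd, hgd, stepCauchy_zero _ _ _ _ p, fun z hz => ⟨hfhg z hz, hderiv z hz⟩⟩, hdiffeo⟩
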